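/- All graphs are finite and simple. For graphs $H_1,\dots,H_m$, a graph is $\{H_1,\dots,H_m\}$-free if none of its induced subgraphs is isomorphic to any $H_i$. A tree decomposition of a graph $G$ is a pair $(T,\beta)$ of a tree $T$ and a map $\beta\colon V(T)\to 2^{V(G)}$ such that every vertex of $G$ lies in some bag $\beta(t)$, both ends of every edge of $G$ lie in a common bag, and for every $v\in V(G)$ the set $\{t\in V(T) : v\in\beta(t)\}$ induces a subtree of $T$. The tree-independence number $\mathsf{tree}\text{-}\alpha(G)$ is the minimum, over all tree decompositions $(T,\beta)$ of $G$, of $\max_{t\in V(T)}\alpha(G[\beta(t)])$, where $\alpha$ denotes the independence number. A class of graphs has bounded tree-independence number if there is a constant $c$ such that $\mathsf{tree}\text{-}\alpha(G)\le c$ for all $G$ in the class. Let $\mathcal{S}$ be the family of graphs every component of which is a tree with at most three leaves, and let $L(\mathcal{S})$ be the family of all line graphs of graphs in $\mathcal{S}$. For $p\ge 1$, let $S_p$ be the graph obtained from the claw $K_{1,3}$ by subdividing each of its three edges $p-1$ times, and let $T_p$ be the line graph of $S_p$. For a graph $H$ and $k\ge 1$, let $kH$ be the disjoint union of $k$ copies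 of $H$. **Theorem.** 1. For every positive integer $d$ and any two graphs $S\in\mathcal{S}$ and $T\in L(\mathcal{S})$, the class of $\{K_{1,d},S,T\}$-free graphs has bounded tree-independence number. 2. For all positive integers $d,k,p$, every $\{K_{1,d},kS_p,kT_p\}$-free graph $G$ satisfies $$\mathsf{tree}\text{-}\alpha(G) < 6dk(p+1)+20d^4(p+1).$$ -/

import Mathlib

open scoped SimpleGraph

universe u v w

/-- A tree decomposition of `G`: a finite tree together with bags, such that every vertex lies in
some bag, both ends of every edge lie in a common bag, and for every vertex `v` the nodes whose bag
contains `v` induce a (connected) subtree. -/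
structure TreeDecomposition {V : Type u} (G : SimpleGraph V) where
  Node : Type
  finite_node : Finite Node
  tree : SimpleGraph Node
  isTree : tree.IsTree
  bag : Node → Set V
  exists_mem_bag : ∀ v : V, ∃ t, v ∈ bag t
  exists_edge_bag : ∀ x y : V, G.Adj x y → ∃ t, x ∈ bag t ∧ y ∈ bag t
  subtree : ∀ v : V, (tree.induce {t | v ∈ bag t}).IsTree

/-- The independence number of a tree decomposition: the maximum over its (finitely many) nodes of
the independence number of the subgraph induced by the bag. -/
noncomputable def TreeDecomposition.indepNum {V : Type u} {G : SimpleGraph V}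
    (D : TreeDecomposition G) : ℕ :=
  ⨆ t : D.Node, (G.induce (D.bag t)).indepNum

/-- The tree-independence number of `G`: the minimum independence number of a tree decomposition
of `G`. -/
noncomputable def treeIndepNum {V : Type u} (G : SimpleGraph V) : ℕ :=
  sInf (Set.range fun D : TreeDecomposition G => D.indepNum)

/-- `G` is `H`-free: no induced subgraph of `G` is isomorphic to `H`. -/
def IsFreeOf {V : Type u} {W : Type w} (G : SimpleGraph V) (H : SimpleGraph W) : Prop :=
  ¬ H ⊴ G

/-- The star `K_{1,d}`. -/
abbrev starGraphK (d : ℕ) : SimpleGraph (Fin 1 ⊕ Fin d) :=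
  completeBipartiteGraph (Fin 1) (Fin d)

/-- The leaves of a graph: the vertices with exactly one neighbour. -/
def leafSet {V : Type u} (G : SimpleGraph V) : Set V :=
  {x | (G.neighborSet x).ncard = 1}

/-- The family `𝒮` of the finite graphs every component of which is a tree with at most three
leaves. -/
def InFamilyS {V : Type u} (G : SimpleGraph V) : Prop :=
  Finite V ∧ ∀ C : G.ConnectedComponent,
    C.toSimpleGraph.IsTree ∧ (leafSet C.toSimpleGraph).ncard ≤ 3

/-- The family `L(𝒮)` of the line graphs of the graphs in `𝒮` (up to isomorphism). -/
def InFamilyLS {V : Type u} (G : SimpleGraph V) : Prop :=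
  ∃ (n : ℕ) (H : SimpleGraph (Fin n)), InFamilyS H ∧ Nonempty (G ≃g H.lineGraph)

/-- The graph `S_p = S_{p,p,p}`, the claw with each of its three edges subdivided `p - 1` times
(for `p ≥ 1`): the centre is `none`, and the vertices of the `i`-th leg, ordered from the centre
outwards, are `some (i, 0), …, some (i, p - 1)`. -/
def subdividedClaw (p : ℕ) : SimpleGraph (Option (Fin 3 × Fin p)) where
  Adj x y :=
    match x, y with
    | none, none => False
    | none, some b => (b.2 : ℕ) = 0
    | some a, none => (a.2 : ℕ) = 0
    | some a, some b =>
      a.1 = b.1 ∧ ((a.2 : ℕ) + 1 = (b.2 : ℕ) ∨ (b.2 : ℕ) + 1 = (a.2 : ℕ))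
  symm := ⟨by
    rintro (_ | a) (_ | b) h
    · exact h
    · exact h
    · exact h
    · exact ⟨h.1.symm, h.2.symm⟩⟩
  loopless := ⟨by
    rintro (_ | a) h
    · exact h
    · rcases h.2 with h | h <;> omega⟩

/-- The graph `T_p`, the line graph of `S_p`. -/
abbrev lineSubdividedClaw (p : ℕ) : SimpleGraph (subdividedClaw p).edgeSet :=
  (subdividedClaw p).lineGraph

/-- The disjoint union `kH` of `k` copies of the graph `H`. -/
def disjointCopies (k : ℕ) {W : Type w} (H : SimpleGraph W) : SimpleGraph (Fin k × W) where
  Adj x y := x.1 = y.1 ∧ H.Adj x.2 y.2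
  symm := ⟨fun _ _ h => ⟨h.1.symm, h.2.symm⟩⟩
  loopless := ⟨fun _ h => H.loopless.irrefl _ h.2⟩

/-! The core is a balanced-separator statement. If a $K_{1,d}$-free graph contains neither $S_p$ nor
$T_p$, then for every vertex set $I$ some set $Y$ of at most $3d(p+1)$ vertices has a closed
neighbourhood $N[Y]$ such that no component of $G-N[Y]$ contains more than half of $I$.
Star-freeness gives $\alpha(N[Y])\le d|Y|$, so this separator has bounded independence number
(`exists_balanced_separator`).

Suppose it fails, so that every small $Y$ leaves a majority component. Take two anticomplete legs,
each empty or an induced path on $d(p+1)$ vertices, whose majority component $B$ is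
inclusion-minimal. A Gyárfás-path argument grows a third leg inside $B$
(`IsMajority.exists_indPath`). The majority component $D$ beyond all three legs is strictly smaller
than $B$, so by minimality no two legs suffice to cut off $D$. Hence for each leg $D$ has a
neighbour $x_i$ in the neighbourhood of that leg and of neither other leg. Star-freeness yields in
each leg a subpath hanging from $x_i$ by its first vertex only (`exists_pendant_subpath`), and three
such legs on the connected set $D\cup\{x_0,x_1,x_2\}$ force $S_p$ or $T_p$
(`claw_or_line_of_three_legs`).

Balanced separators with $\alpha\le c$ yield, by the Robertson–Seymour recursion with $\alpha$ in
place of cardinality, a tree decomposition whose bags have $\alpha\le 5c$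
(`LeafDecomposition.extend`).

If only $kS_p$ and $kT_p$ are excluded, deleting the closed neighbourhood of a largest anticomplete
packing of copies of $S_p$, and likewise for $T_p$, destroys all copies. The deleted set has bounded
$\alpha$ and is put back into every bag. Part 1 follows since every member of $\mathcal S$ embeds in
some $kS_p$, and every member of $L(\mathcal S)$ in some $kT_p$. -/

/-- The first `n` terms of `f` are distinct and induce the path visiting them in this order. -/
structure IndPath {V : Type u} (G : SimpleGraph V) (f : ℕ → V) (n : ℕ) : Prop where
  inj : ∀ i j, i < n → j < n → f i = f j → i = j
  adj : ∀ i j, i < n → j < n → (G.Adj (f i) (f j) ↔ i + 1 = j ∨ j + 1 = i)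

/-- No term of the first sequence is equal or adjacent to a term of the second. -/
def Anticomplete {V : Type u} (G : SimpleGraph V) (f : ℕ → V) (m : ℕ) (g : ℕ → V) (n : ℕ) : Prop :=
  ∀ i j, i < m → j < n → f i ≠ g j ∧ ¬ G.Adj (f i) (g j)

/-- `C` induces a connected (possibly empty) subgraph: it has no proper nonempty subset that is
closed under adjacency inside `C`. -/
def ConnSet {V : Type u} (G : SimpleGraph V) (C : Set V) : Prop :=
  ∀ S ⊆ C, S.Nonempty → (∀ x ∈ S, ∀ y ∈ C, G.Adj x y → y ∈ S) → C ⊆ S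

namespace IndPath

variable {V : Type u} {G : SimpleGraph V} {f g : ℕ → V} {m n : ℕ}

lemma mono (h : IndPath G f n) (hm : m ≤ n) : IndPath G f m :=
  ⟨fun i j hi hj => h.inj i j (by omega) (by omega),
    fun i j hi hj => h.adj i j (by omega) (by omega)⟩

lemma shift (h : IndPath G f n) (a : ℕ) (hm : a + m ≤ n) : IndPath G (fun i => f (a + i)) m :=
  ⟨fun i j hi hj e => by have := h.inj _ _ (by omega) (by omega) e; omega,
    fun i j hi hj => by rw [h.adj _ _ (by omega) (by omega)]; omega⟩

lemma rev (h : IndPath G f n) (a : ℕ) (ha : a < n) (hm : m ≤ a + 1) :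
    IndPath G (fun i => f (a - i)) m :=
  ⟨fun i j hi hj e => by have := h.inj _ _ (by omega) (by omega) e; omega,
    fun i j hi hj => by rw [h.adj _ _ (by omega) (by omega)]; omega⟩

lemma append (hf : IndPath G f m) (hg : IndPath G g n)
    (hne : ∀ i j, i < m → j < n → f i ≠ g j)
    (hadj : ∀ i j, i < m → j < n → (G.Adj (f i) (g j) ↔ i + 1 = m ∧ j = 0)) :
    IndPath G (fun i => if i < m then f i else g (i - m)) (m + n) := by
  constructor
  · intro i j hi hj e
    split_ifs at e with h1 h2 h2
    · exact hf.inj _ _ h1 h2 e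
    · exact absurd e (hne _ _ h1 (by omega))
    · exact absurd e.symm (hne _ _ h2 (by omega))
    · have := hg.inj _ _ (by omega) (by omega) e
      omega
  · intro i j hi hj
    split_ifs with h1 h2 h2
    · exact hf.adj _ _ h1 h2
    · rw [hadj _ _ h1 (by omega)]; omega
    · rw [G.adj_comm, hadj _ _ h2 (by omega)]; omega
    · rw [hg.adj _ _ (by omega) (by omega)]; omega

end IndPath

/-! ### Recognising $S_p$ and $T_p$ from their legs -/

section Shapes

variable {V : Type u} {G : SimpleGraph V}

lemma Anticomplete.symm {f g : ℕ → V} {m n : ℕ} (h : Anticomplete G f m g n) :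
    Anticomplete G g n f m :=
  fun i j hi hj => ⟨(h j i hj hi).1.symm, fun e => (h j i hj hi).2 e.symm⟩

lemma forall_fin_three_ne {P : Fin 3 → Fin 3 → Prop} (hs : ∀ i j, P i j → P j i)
    (h01 : P 0 1) (h02 : P 0 2) (h12 : P 1 2) (i j : Fin 3) (hij : i ≠ j) : P i j := by
  fin_cases i <;> fin_cases j <;>
    first | exact absurd rfl hij | assumption | (apply hs; assumption)

lemma subdividedClaw_indContained {p : ℕ} (c : V) (a : Fin 3 → ℕ → V)
    (ha : ∀ i, IndPath G (a i) p) (hc : ∀ i k, k < p → c ≠ a i k ∧ (G.Adj c (a i k) ↔ k = 0))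
    (hanti : ∀ i j, i ≠ j → Anticomplete G (a i) p (a j) p) : subdividedClaw p ⊴ G := by
  refine ⟨⟨⟨fun x => x.elim c fun y => a y.1 y.2, ?_⟩, ?_⟩⟩
  · rintro (_ | ⟨i, k⟩) (_ | ⟨j, l⟩) h
    · rfl
    · exact absurd h (hc j l l.2).1
    · exact absurd h.symm (hc i k k.2).1
    · by_cases hij : i = j
      · subst hij
        have := (ha i).inj _ _ k.2 l.2 h
        rw [Fin.ext this]
      · exact absurd h (hanti i j hij _ _ k.2 l.2).1
  · rintro (_ | ⟨i, k⟩) (_ | ⟨j, l⟩)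
    · simp [subdividedClaw]
    · exact (hc j l l.2).2
    · exact (G.adj_comm _ _).trans (hc i k k.2).2
    · by_cases hij : i = j
      · subst hij
        refine ((ha i).adj _ _ k.2 l.2).trans ?_
        simp [subdividedClaw]
      · refine (iff_false_intro (hanti i j hij _ _ k.2 l.2).2).trans ?_
        simp [subdividedClaw, hij]

/-- Three paths with `p` vertices whose first vertices form a triangle. -/
def netGraph (p : ℕ) : SimpleGraph (Fin 3 × Fin p) where
  Adj a b := (a.1 = b.1 ∧ ((a.2 : ℕ) + 1 = b.2 ∨ (b.2 : ℕ) + 1 = a.2)) ∨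
    (a.1 ≠ b.1 ∧ (a.2 : ℕ) = 0 ∧ (b.2 : ℕ) = 0)
  symm := ⟨fun a b h => by
    rcases h with ⟨h, h'⟩ | ⟨h, h', h''⟩
    · exact Or.inl ⟨h.symm, h'.symm⟩
    · exact Or.inr ⟨h.symm, h'', h'⟩⟩
  loopless := ⟨fun a h => by
    rcases h with ⟨_, h⟩ | ⟨h, _⟩
    · omega
    · exact h rfl⟩

/-- The neighbour of `some a` in the subdivided claw on the side of the centre. -/
def clawParent {p : ℕ} (a : Fin 3 × Fin p) : Option (Fin 3 × Fin p) :=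
  if (a.2 : ℕ) = 0 then none else some (a.1, ⟨a.2 - 1, by omega⟩)

lemma clawParent_adj {p : ℕ} (a : Fin 3 × Fin p) :
    (subdividedClaw p).Adj (clawParent a) (some a) := by
  unfold clawParent
  split_ifs with h
  · exact h
  · exact ⟨rfl, Or.inl (by simp only; omega)⟩

lemma adj_some_iff {p : ℕ} (x : Option (Fin 3 × Fin p)) (y : Option (Fin 3 × Fin p)) :
    (subdividedClaw p).Adj x y ↔ ∃ a, (x = clawParent a ∧ y = some a) ∨
      (x = some a ∧ y = clawParent a) := by
  constructor
  · intro h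
    rcases x with _ | ⟨i, k⟩ <;> rcases y with _ | ⟨j, l⟩
    · exact h.elim
    · exact ⟨_, Or.inl ⟨(if_pos h).symm, rfl⟩⟩
    · exact ⟨_, Or.inr ⟨rfl, (if_pos h).symm⟩⟩
    · obtain ⟨rfl, h | h⟩ := h
      · refine ⟨_, Or.inl ⟨?_, rfl⟩⟩
        simp only at h
        rw [clawParent, if_neg (by simp only; omega)]
        congr 2
        ext
        simp only; omega
      · refine ⟨_, Or.inr ⟨rfl, ?_⟩⟩
        simp only at h
        rw [clawParent, if_neg (by simp only; omega)]
        congr 2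
        ext
        simp only; omega
  · rintro ⟨a, ⟨rfl, rfl⟩ | ⟨rfl, rfl⟩⟩
    · exact clawParent_adj a
    · exact (clawParent_adj a).symm

lemma clawParent_eq_some_iff {p : ℕ} (a b : Fin 3 × Fin p) :
    clawParent a = some b ↔ a.1 = b.1 ∧ (b.2 : ℕ) + 1 = a.2 := by
  obtain ⟨i, k⟩ := a
  obtain ⟨j, l⟩ := b
  unfold clawParent
  split_ifs with h
  · simp only at h ⊢
    simp only [false_iff]
    omega
  · simp only [Option.some.injEq, Prod.mk.injEq, Fin.ext_iff] at h ⊢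
    omega

/-- The edge of the subdivided claw joining `some a` to its neighbour towards the centre. -/
def clawEdge {p : ℕ} (a : Fin 3 × Fin p) : (subdividedClaw p).edgeSet :=
  ⟨s(clawParent a, some a), clawParent_adj a⟩

/-- Rooted at its centre, the claw is a tree, so an edge is determined by its outer end; $E(S_p)$ is
thus indexed by the non-central vertices. -/
lemma clawEdge_bijective (p : ℕ) : Function.Bijective (clawEdge (p := p)) := by
  constructor
  · intro a b h
    have h' : s(clawParent a, some a) = s(clawParent b, some b) := congrArg Subtype.val h
    rw [Sym2.eq_iff] at h'
    rcases h' with ⟨_, h'⟩ | ⟨h1, h2⟩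
    · exact Option.some.inj h'
    · rw [clawParent_eq_some_iff] at h1
      rw [eq_comm, clawParent_eq_some_iff] at h2
      omega
  · rintro ⟨e, he⟩
    induction e with | _ x y
    rw [SimpleGraph.mem_edgeSet, adj_some_iff] at he
    obtain ⟨a, ⟨rfl, rfl⟩ | ⟨rfl, rfl⟩⟩ := he
    · exact ⟨a, rfl⟩
    · exact ⟨a, Subtype.ext Sym2.eq_swap⟩

lemma clawParent_eq_clawParent_iff {p : ℕ} (a b : Fin 3 × Fin p) :
    clawParent a = clawParent b ↔ a = b ∨ ((a.2 : ℕ) = 0 ∧ (b.2 : ℕ) = 0) := by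
  obtain ⟨i, k⟩ := a
  obtain ⟨j, l⟩ := b
  unfold clawParent
  split_ifs with h h' h'
  · exact iff_of_true rfl (Or.inr ⟨h, h'⟩)
  · simp only [Prod.mk.injEq, Fin.ext_iff, false_iff] at h h' ⊢
    omega
  · simp only [Prod.mk.injEq, Fin.ext_iff, false_iff] at h h' ⊢
    omega
  · simp only [Option.some.injEq, Prod.mk.injEq, Fin.ext_iff] at h h' ⊢
    omega

lemma clawEdge_adj_iff {p : ℕ} (a b : Fin 3 × Fin p) :
    (lineSubdividedClaw p).Adj (clawEdge a) (clawEdge b) ↔ (netGraph p).Adj a b := by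
  rw [SimpleGraph.lineGraph_adj_iff_exists, (clawEdge_bijective p).1.ne_iff]
  have : (∃ v, v ∈ (clawEdge a : Sym2 (Option (Fin 3 × Fin p))) ∧
      v ∈ (clawEdge b : Sym2 (Option (Fin 3 × Fin p)))) ↔
      clawParent a = clawParent b ∨ clawParent a = some b ∨ clawParent b = some a ∨ a = b := by
    simp only [clawEdge, Sym2.mem_iff]
    constructor
    · rintro ⟨v, rfl | rfl, h | h⟩
      · exact Or.inl h
      · exact Or.inr (Or.inl h)
      · exact Or.inr (Or.inr (Or.inl h.symm))
      · exact Or.inr (Or.inr (Or.inr (Option.some.inj h)))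
    · rintro (h | h | h | rfl)
      · exact ⟨_, Or.inl rfl, Or.inl h⟩
      · exact ⟨_, Or.inl rfl, Or.inr h⟩
      · exact ⟨_, Or.inr rfl, Or.inl h.symm⟩
      · exact ⟨_, Or.inl rfl, Or.inl rfl⟩
  rw [this, clawParent_eq_some_iff, clawParent_eq_some_iff, clawParent_eq_clawParent_iff]
  obtain ⟨i, k⟩ := a
  obtain ⟨j, l⟩ := b
  simp only [netGraph, Prod.mk.injEq, ne_eq, Fin.ext_iff]
  omega

/-- The line graph of the subdivided claw is a triangle with three pendant paths. -/
noncomputable def netGraphIso (p : ℕ) : netGraph p ≃g lineSubdividedClaw p where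
  toEquiv := Equiv.ofBijective _ (clawEdge_bijective p)
  map_rel_iff' := clawEdge_adj_iff _ _

/-- Passing through `netGraph` lets the vertices of $T_p$ be handled as pairs (leg, position)
instead of edges. -/
lemma lineSubdividedClaw_indContained {p : ℕ} (a : Fin 3 → ℕ → V)
    (ha : ∀ i, IndPath G (a i) p)
    (hanti : ∀ i j, i ≠ j → ∀ k l, k < p → l < p →
      a i k ≠ a j l ∧ (G.Adj (a i k) (a j l) ↔ k = 0 ∧ l = 0)) :
    lineSubdividedClaw p ⊴ G := by
  suffices netGraph p ⊴ G from SimpleGraph.IsIndContained.trans ⟨(netGraphIso p).symm.toEmbedding⟩ this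
  refine ⟨⟨⟨fun y => a y.1 y.2, ?_⟩, ?_⟩⟩
  · rintro ⟨i, k⟩ ⟨j, l⟩ h
    by_cases hij : i = j
    · subst hij
      have := (ha i).inj _ _ k.2 l.2 h
      rw [Fin.ext this]
    · exact absurd h (hanti i j hij _ _ k.2 l.2).1
  · rintro ⟨i, k⟩ ⟨j, l⟩
    by_cases hij : i = j
    · subst hij
      refine ((ha i).adj _ _ k.2 l.2).trans ?_
      simp [netGraph]
    · refine (hanti i j hij _ _ k.2 l.2).2.trans ?_
      simp [netGraph, hij]

end Shapes

/-! ### Three legs attached to a connected set -/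

section ThreeLegs

variable {V : Type u} {G : SimpleGraph V}

/-- A shortest path from `t` through a connected set to a set `R` is an induced path meeting `R`
only in its last vertex. -/
lemma ConnSet.exists_indPath {K : Set V} (hK : ConnSet G K) {t : V}
    (htK : ∃ y ∈ K, G.Adj t y) {R : Set V} (hR : ∃ r ∈ K, r ∈ R) :
    ∃ (f : ℕ → V) (j : ℕ), IndPath G f (j + 1) ∧ f 0 = t ∧ (∀ i, 1 ≤ i → i ≤ j → f i ∈ K) ∧
      f j ∈ R ∧ ∀ i < j, f i ∉ R := by
  classical
  let W : ℕ → V → Prop := fun j x => ∃ f : ℕ → V, f 0 = t ∧ (∀ i, 1 ≤ i → i ≤ j → f i ∈ K) ∧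
    (∀ i < j, G.Adj (f i) (f (i + 1))) ∧ f j = x
  have hreach : K ⊆ {x | x ∈ K ∧ ∃ j, W j x} := by
    apply hK _ (fun x hx => hx.1)
    · obtain ⟨y, hy, hty⟩ := htK
      refine ⟨y, hy, 1, fun i => if i = 0 then t else y, by simp, ?_, ?_, by simp⟩
      · intro i hi _
        simpa [show i ≠ 0 by omega] using hy
      · intro i hi
        simpa [show i = 0 by omega] using hty
    · rintro x ⟨-, j, f, h0, hfK, hadj, rfl⟩ y hy hxy
      refine ⟨hy, j + 1, fun i => if i ≤ j then f i else y, by simpa using h0, ?_, ?_, by simp⟩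
      · intro i hi hij
        dsimp only
        split_ifs with h
        · exact hfK i hi h
        · exact hy
      · intro i hi
        by_cases h : i + 1 ≤ j
        · simpa [h, show i ≤ j by omega] using hadj i h
        · obtain rfl : i = j := by omega
          simpa using hxy
  have hex : ∃ j, ∃ x ∈ R, W j x := by
    obtain ⟨r, hrK, hr⟩ := hR
    obtain ⟨-, j, hj⟩ := hreach hrK
    exact ⟨j, r, hr, hj⟩
  obtain ⟨x, hx, f, h0, hfK, hadj, rfl⟩ := Nat.find_spec hex
  set j := Nat.find hex with hj
  have hmin : ∀ i < j, f i ∉ R := by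
    intro i hi hfi
    exact Nat.find_min hex hi ⟨f i, hfi, f, h0, fun k hk hki => hfK k hk (by omega),
      fun k hk => hadj k (by omega), rfl⟩
  -- a chord or a repetition gives a shortcut
  have hshort : ∀ a b, a < b → b ≤ j → G.Adj (f a) (f b) → b = a + 1 := by
    intro a b hab hbj hadjab
    by_contra hne
    refine Nat.find_min hex (m := j - (b - a - 1)) (by omega)
      ⟨f j, hx, fun i => if i ≤ a then f i else f (i + (b - a - 1)), by simpa using h0, ?_, ?_, ?_⟩
    · intro i hi hij
      dsimp only
      split_ifs with h
      · exact hfK i hi (by omega)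
      · exact hfK _ (by omega) (by omega)
    · intro i hi
      by_cases h : i + 1 ≤ a
      · simpa [h, show i ≤ a by omega] using hadj i (by omega)
      · by_cases h' : i = a
        · subst h'
          simpa [show i + 1 + (b - i - 1) = b by omega] using hadjab
        · have := hadj (i + (b - a - 1)) (by omega)
          simpa [h, show ¬ i ≤ a by omega,
            show i + 1 + (b - a - 1) = i + (b - a - 1) + 1 by omega] using this
    · have : ¬ j - (b - a - 1) ≤ a := by omega
      simp only [this, if_false]
      congr 1
      omega
  -- If `f a = f b` with `b < j`, then `f a` is adjacent to `f (b + 1)`, a forbidden chord; if `b =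
  -- j`, the walk met `R` too early.
  have hinj : ∀ a b, a < b → b ≤ j → f a ≠ f b := by
    intro a b hab hbj he
    rcases hbj.lt_or_eq with h | rfl
    · have h1 := hadj b h
      rw [← he] at h1
      have := hshort a (b + 1) (by omega) (by omega) h1
      omega
    · exact hmin a hab (he ▸ hx)
  refine ⟨f, j, ⟨?_, ?_⟩, h0, hfK, hx, hmin⟩
  · intro a b ha hb he
    rcases lt_trichotomy a b with h | h | h
    · exact absurd he (hinj a b h (by omega))
    · exact h
    · exact absurd he.symm (hinj b a h (by omega))
  · intro a b ha hb
    constructor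
    · intro h
      rcases lt_trichotomy a b with h' | rfl | h'
      · exact Or.inl (hshort a b h' (by omega) h).symm
      · exact absurd h (G.irrefl)
      · exact Or.inr (hshort b a h' (by omega) h.symm).symm
    · rintro (rfl | rfl)
      · exact hadj a (by omega)
      · exact (hadj b (by omega)).symm

/-- A long path with an induced path attached, by its first vertex only, to the middle part. -/
lemma claw_or_line_of_path_and_tail {P L : ℕ → V} {n p : ℕ} (hP : IndPath G P n)
    (hL : IndPath G L (p + 1)) (hne : ∀ i k, i < n → k < p + 1 → P i ≠ L k)
    (hadj : ∀ i k, i < n → 1 ≤ k → k < p + 1 → ¬ G.Adj (P i) (L k))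
    (hex : ∃ i < n, G.Adj (P i) (L 0))
    (hmid : ∀ i < n, G.Adj (P i) (L 0) → p ≤ i ∧ i + p < n) :
    subdividedClaw p ⊴ G ∨ lineSubdividedClaw p ⊴ G := by
  classical
  obtain ⟨hlo, hloadj⟩ := Nat.find_spec hex
  have hlomin : ∀ i, i < n → G.Adj (P i) (L 0) → Nat.find hex ≤ i :=
    fun i hi h => Nat.find_min' hex ⟨hi, h⟩
  set lo := Nat.find hex
  obtain ⟨hi, hhi, hhiadj, hhimax⟩ : ∃ hi < n, G.Adj (P hi) (L 0) ∧
      ∀ i, i < n → G.Adj (P i) (L 0) → i ≤ hi := by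
    let S := (Finset.range n).filter fun i => G.Adj (P i) (L 0)
    have hS : S.Nonempty := ⟨lo, by simp [S, hlo, hloadj]⟩
    have h1 := S.max'_mem hS
    simp only [S, Finset.mem_filter, Finset.mem_range] at h1
    exact ⟨S.max' hS, h1.1, h1.2, fun i hi h => S.le_max' i (by simp [S, hi, h])⟩
  have hle : lo ≤ hi := hlomin hi hhi hhiadj
  obtain ⟨hlop, -⟩ := hmid lo hlo hloadj
  obtain ⟨-, hhip⟩ := hmid hi hhi hhiadj
  have hPP : ∀ i j, i < n → j < n → i + 1 < j → P i ≠ P j ∧ ¬ G.Adj (P i) (P j) := by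
    intro i j hi hj hij
    refine ⟨fun e => ?_, fun e => ?_⟩
    · have := hP.inj i j hi hj e; omega
    · rw [hP.adj i j hi hj] at e; omega
  -- Let `lo` and `hi` be the first and last neighbours of `L 0` on `P`. If they coincide, `P lo` is
  -- the centre of a claw; if they are consecutive, they form a triangle with `L 0`; otherwise `L 0`
  -- is the centre of a claw and the part of `P` strictly between them is discarded.
  rcases hle.eq_or_lt with heq | hlt
  · left
    have honly : ∀ i < n, G.Adj (P i) (L 0) → i = lo := by
      intro i hi' h
      have := hlomin i hi' h
      have := hhimax i hi' h
      omega
    refine subdividedClaw_indContained (P lo)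
      ![fun k => P (lo - 1 - k), fun k => P (lo + 1 + k), L] ?_ ?_ ?_
    · intro i
      fin_cases i
      · rcases Nat.eq_zero_or_pos p with rfl | hp
        · exact ⟨by simp, by simp⟩
        · exact hP.rev (lo - 1) (by omega) (by omega)
      · exact hP.shift (lo + 1) (by omega)
      · exact hL.mono (by omega)
    · intro i k hk
      fin_cases i
      · refine ⟨fun e => ?_, ?_⟩
        · have := hP.inj _ _ (by omega) (by omega) e; omega
        · refine (hP.adj _ _ (by omega) (by omega)).trans ?_; omega
      · refine ⟨fun e => ?_, ?_⟩
        · have := hP.inj _ _ (by omega) (by omega) e; omega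
        · refine (hP.adj _ _ (by omega) (by omega)).trans ?_; omega
      · refine ⟨hne _ _ hlo (by omega), ⟨fun h => ?_, ?_⟩⟩
        · by_contra hk0
          exact hadj lo k hlo (by omega) (by omega) h
        · rintro rfl; exact hloadj
    · refine forall_fin_three_ne (fun i j h => h.symm) ?_ ?_ ?_
      · intro k l hk hl
        exact hPP _ _ (by omega) (by omega) (by omega)
      · intro k l hk hl
        refine ⟨hne _ _ (by omega) (by omega), fun h => ?_⟩
        rcases Nat.eq_zero_or_pos l with rfl | hl0
        · have := honly _ (by omega) h; omega
        · exact hadj _ _ (by omega) hl0 (by omega) h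
      · intro k l hk hl
        refine ⟨hne _ _ (by omega) (by omega), fun h => ?_⟩
        rcases Nat.eq_zero_or_pos l with rfl | hl0
        · have := honly _ (by omega) h; omega
        · exact hadj _ _ (by omega) hl0 (by omega) h
  rcases Nat.eq_or_lt_of_le hlt with heq | hlt2
  · right
    refine lineSubdividedClaw_indContained
      ![fun k => P (lo - k), fun k => P (hi + k), L] ?_ ?_
    · intro i
      fin_cases i
      · exact hP.rev lo (by omega) (by omega)
      · exact hP.shift hi (by omega)
      · exact hL.mono (by omega)
    · refine forall_fin_three_ne (fun i j h k l hk hl => ?_) ?_ ?_ ?_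
      · rw [ne_comm, G.adj_comm, and_comm (a := k = 0)]; exact h l k hl hk
      · intro k l hk hl
        refine ⟨fun e => ?_, ?_⟩
        · have := hP.inj _ _ (by omega) (by omega) e; omega
        · refine (hP.adj _ _ (by omega) (by omega)).trans ?_; omega
      · intro k l hk hl
        refine ⟨hne _ _ (by omega) (by omega), fun h => ?_, ?_⟩
        · rcases Nat.eq_zero_or_pos l with rfl | hl0
          · have := hlomin _ (by omega) h; omega
          · exact absurd h (hadj _ _ (by omega) hl0 (by omega))
        · rintro ⟨rfl, rfl⟩; exact hloadj
      · intro k l hk hl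
        refine ⟨hne _ _ (by omega) (by omega), fun h => ?_, ?_⟩
        · rcases Nat.eq_zero_or_pos l with rfl | hl0
          · have := hhimax _ (by omega) h; omega
          · exact absurd h (hadj _ _ (by omega) hl0 (by omega))
        · rintro ⟨rfl, rfl⟩; exact hhiadj
  · left
    refine subdividedClaw_indContained (L 0)
      ![fun k => P (lo - k), fun k => P (hi + k), fun k => L (1 + k)] ?_ ?_ ?_
    · intro i
      fin_cases i
      · exact hP.rev lo (by omega) (by omega)
      · exact hP.shift hi (by omega)
      · exact hL.shift 1 (by omega)
    · intro i k hk
      fin_cases i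
      · refine ⟨(hne _ _ (by omega) (by omega)).symm, fun h => ?_, ?_⟩
        · have := hlomin _ (by omega) h.symm; omega
        · rintro rfl; exact hloadj.symm
      · refine ⟨(hne _ _ (by omega) (by omega)).symm, fun h => ?_, ?_⟩
        · have := hhimax _ (by omega) h.symm; omega
        · rintro rfl; exact hhiadj.symm
      · refine ⟨fun e => ?_, ?_⟩
        · have := hL.inj _ _ (by omega) (by omega) e; omega
        · refine (hL.adj _ _ (by omega) (by omega)).trans ?_; omega
    · refine forall_fin_three_ne (fun i j h => h.symm) ?_ ?_ ?_
      · intro k l hk hl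
        exact hPP _ _ (by omega) (by omega) (by omega)
      · intro k l hk hl
        exact ⟨hne _ _ (by omega) (by omega), hadj _ _ (by omega) (by omega) (by omega)⟩
      · intro k l hk hl
        exact ⟨hne _ _ (by omega) (by omega), hadj _ _ (by omega) (by omega) (by omega)⟩

/-- Three pairwise anticomplete induced paths attached by their first vertices to a connected set. -/
lemma claw_or_line_of_three_legs {p : ℕ} {K : Set V} (hK : ConnSet G K) (a : Fin 3 → ℕ → V)
    (ha : ∀ i, IndPath G (a i) (p + 1))
    (hanti : ∀ i j, i ≠ j → Anticomplete G (a i) (p + 1) (a j) (p + 1))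
    (haK : ∀ i k, k < p + 1 → a i k ∉ K)
    (h0 : ∀ i, ∃ y ∈ K, G.Adj (a i 0) y)
    (hpos : ∀ i k, 1 ≤ k → k < p + 1 → ∀ y ∈ K, ¬ G.Adj (a i k) y) :
    subdividedClaw p ⊴ G ∨ lineSubdividedClaw p ⊴ G := by
  have h01 := hanti 0 1 (by decide)
  have h02 := hanti 0 2 (by decide)
  have h12 := hanti 1 2 (by decide)
  obtain ⟨f, j, hf, hf0, hfK, hfj, hfR⟩ := hK.exists_indPath (h0 0)
    (R := {y | G.Adj (a 1 0) y}) (h0 1)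
  have hj : 1 ≤ j := by
    by_contra h
    obtain rfl : j = 0 := by omega
    rw [hf0] at hfj
    exact (h01 0 0 (by omega) (by omega)).2 (SimpleGraph.Adj.symm hfj)
  -- the path `f` followed by the second leg
  have hQ : IndPath G (fun i => if i < j + 1 then f i else a 1 (i - (j + 1))) (j + 1 + (p + 1)) := by
    refine hf.append (ha 1) ?_ ?_
    · intro i k hi hk e
      rcases Nat.eq_zero_or_pos i with rfl | hi0
      · exact (h01 0 k (by omega) hk).1 (hf0 ▸ e)
      · exact haK 1 k hk (e ▸ hfK i hi0 (by omega))
    · intro i k hi hk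
      constructor
      · intro h
        rcases Nat.eq_zero_or_pos i with rfl | hi0
        · exact absurd (hf0 ▸ h) (h01 0 k (by omega) hk).2
        · rcases Nat.eq_zero_or_pos k with rfl | hk0
          · refine ⟨?_, rfl⟩
            by_contra hne
            exact hfR i (by omega) (SimpleGraph.Adj.symm h)
          · exact absurd h.symm (hpos 1 k hk0 hk _ (hfK i hi0 (by omega)))
      · rintro ⟨h, rfl⟩
        obtain rfl : i = j := by omega
        exact SimpleGraph.Adj.symm hfj
  set Q : ℕ → V := fun i => if i < j + 1 then f i else a 1 (i - (j + 1)) with hQdef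
  have hQf : ∀ i, i < j + 1 → Q i = f i := fun i hi => if_pos hi
  have hQa : ∀ i, j + 1 ≤ i → Q i = a 1 (i - (j + 1)) := fun i hi => if_neg (by omega)
  -- `P` runs inwards along leg 0, through `K` by a shortest path, and outwards along leg 1.
  have hP : IndPath G (fun i => if i < p then a 0 (p - i) else Q (i - p)) (p + (j + 1 + (p + 1))) := by
    refine ((ha 0).rev p (by omega) (by omega)).append hQ ?_ ?_
    · intro i k hi hk e
      by_cases hkj : k < j + 1
      · rw [hQf k hkj] at e
        rcases Nat.eq_zero_or_pos k with rfl | hk0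
        · rw [hf0] at e
          have := (ha 0).inj _ _ (by omega) (by omega) e
          omega
        · exact haK 0 (p - i) (by omega) (e ▸ hfK k hk0 (by omega))
      · rw [hQa k (by omega)] at e
        exact (h01 _ _ (by omega) (by omega)).1 e
    · intro i k hi hk
      by_cases hkj : k < j + 1
      · rw [hQf k hkj]
        rcases Nat.eq_zero_or_pos k with rfl | hk0
        · rw [hf0, (ha 0).adj _ _ (by omega) (by omega)]
          omega
        · refine iff_of_false (hpos 0 _ (by omega) (by omega) _ (hfK k hk0 (by omega))) (by omega)
      · rw [hQa k (by omega)]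
        exact iff_of_false (h01 _ _ (by omega) (by omega)).2 (by omega)
  set P : ℕ → V := fun i => if i < p then a 0 (p - i) else Q (i - p) with hPdef
  have hPcase : ∀ i, i < p + (j + 1 + (p + 1)) →
      (i < p ∧ P i = a 0 (p - i)) ∨ (i = p ∧ P i = a 0 0) ∨ (p < i ∧ i ≤ p + j ∧ P i ∈ K) ∨
      (i = p + j + 1 ∧ P i = a 1 0) ∨
      (p + j + 1 < i ∧ P i = a 1 (i - (p + j + 1))) := by
    intro i hi
    by_cases h1 : i < p
    · exact Or.inl ⟨h1, if_pos h1⟩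
    have h2 : P i = Q (i - p) := if_neg h1
    by_cases h3 : i - p < j + 1
    · rw [hQf _ h3] at h2
      rcases Nat.eq_zero_or_pos (i - p) with h4 | h4
      · exact Or.inr (Or.inl ⟨by omega, by rw [h2, h4, hf0]⟩)
      · exact Or.inr (Or.inr (Or.inl ⟨by omega, by omega, h2 ▸ hfK _ h4 (by omega)⟩))
    · rw [hQa _ (by omega), show i - p - (j + 1) = i - (p + j + 1) by omega] at h2
      by_cases h4 : i = p + j + 1
      · exact Or.inr (Or.inr (Or.inr (Or.inl ⟨h4, by rw [h2, h4, Nat.sub_self]⟩)))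
      · exact Or.inr (Or.inr (Or.inr (Or.inr ⟨by omega, h2⟩)))
  -- a shortest path from the third leg to the neighbourhood of `P`
  have hR : ∃ r ∈ K, r ∈ {y | ∃ i < p + (j + 1 + (p + 1)), G.Adj (P i) y} := by
    refine ⟨f 1, hfK 1 le_rfl hj, p, by omega, ?_⟩
    have : P p = f 0 := by
      rw [hPdef]; simp [hQf 0 (by omega)]
    rw [this]
    exact (hf.adj 0 1 (by omega) (by omega)).2 (Or.inl rfl)
  obtain ⟨g, l, hg, hg0, hgK, hgl, hgR⟩ := hK.exists_indPath (h0 2) hR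
  simp only [Set.mem_ofPred_eq, not_exists, not_and] at hgl hgR
  have hPa2 : ∀ i k, i < p + (j + 1 + (p + 1)) → k < p + 1 → P i ≠ a 2 k := by
    intro i k hi hk e
    rcases hPcase i hi with ⟨h, h'⟩ | ⟨h, h'⟩ | ⟨h, h'', h'⟩ | ⟨h, h'⟩ | ⟨h, h'⟩
    · exact (h02 _ _ (by omega) hk).1 (h' ▸ e)
    · exact (h02 _ _ (by omega) hk).1 (h' ▸ e)
    · exact haK 2 k hk (e ▸ h')
    · exact (h12 _ _ (by omega) hk).1 (h' ▸ e)
    · exact (h12 _ _ (by omega) hk).1 (h' ▸ e)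
  have hPa2adj : ∀ i k, i < p + (j + 1 + (p + 1)) → 1 ≤ k → k < p + 1 → ¬ G.Adj (P i) (a 2 k) := by
    intro i k hi hk0 hk e
    rcases hPcase i hi with ⟨h, h'⟩ | ⟨h, h'⟩ | ⟨h, h'', h'⟩ | ⟨h, h'⟩ | ⟨h, h'⟩
    · exact (h02 _ _ (by omega) hk).2 (h' ▸ e)
    · exact (h02 _ _ (by omega) hk).2 (h' ▸ e)
    · exact hpos 2 k hk0 hk _ h' e.symm
    · exact (h12 _ _ (by omega) hk).2 (h' ▸ e)
    · exact (h12 _ _ (by omega) hk).2 (h' ▸ e)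
  have hPg : ∀ i k, i < p + (j + 1 + (p + 1)) → k < l + 1 → P i ≠ g k := by
    intro i k hi hk e
    rcases Nat.eq_zero_or_pos k with rfl | hk0
    · exact hPa2 i 0 hi (by omega) (hg0 ▸ e)
    · refine hgR (k - 1) (by omega) i hi ?_
      rw [e, hg.adj _ _ (by omega) (by omega)]
      omega
  -- The tail starts at the vertex that sees `P`, runs back to the foot of leg 2, and continues
  -- outwards along that leg.
  have hL : IndPath G (fun k => if k < l + 1 then g (l - k) else a 2 (1 + (k - (l + 1))))
      (l + 1 + p) := by
    refine (hg.rev l (by omega) le_rfl).append ((ha 2).shift 1 (by omega)) ?_ ?_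
    · intro i k hi hk e
      rcases Nat.eq_zero_or_pos (l - i) with h | h
      · rw [h, hg0] at e
        have := (ha 2).inj _ _ (by omega) (by omega) e
        omega
      · exact haK 2 _ (by omega) (e ▸ hgK _ h (by omega))
    · intro i k hi hk
      rcases Nat.eq_zero_or_pos (l - i) with h | h
      · rw [h, hg0, (ha 2).adj _ _ (by omega) (by omega)]
        omega
      · refine iff_of_false (fun e => ?_) (by omega)
        exact hpos 2 _ (by omega) (by omega) _ (hgK _ h (by omega)) e.symm
  refine claw_or_line_of_path_and_tail hP (hL.mono (by omega)) ?_ ?_ ?_ ?_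
  · intro i k hi hk
    split_ifs with h
    · exact hPg i _ hi (by omega)
    · exact hPa2 i _ hi (by omega)
  · intro i k hi hk0 hk
    split_ifs with h
    · exact hgR _ (by omega) i hi
    · exact hPa2adj i _ hi (by omega) (by omega)
  · obtain ⟨i, hi, h⟩ := hgl
    exact ⟨i, hi, by simpa using h⟩
  · intro i hi h
    simp only [Nat.zero_lt_succ, if_true, Nat.sub_zero] at h
    -- The head `g l` of the tail lies in `K` or is the foot of leg 2, so it misses all non-first
    -- vertices of legs 0 and 1. Its neighbours on `P` therefore have at least `p` vertices of `P`
    -- on either side.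
    have hpos' : ∀ b k, (b = 0 ∨ b = 1) → 1 ≤ k → k < p + 1 → ¬ G.Adj (a b k) (g l) := by
      intro b k hb hk0 hk hadj
      rcases Nat.eq_zero_or_pos l with rfl | hl
      · rw [hg0] at hadj
        rcases hb with rfl | rfl
        · exact (h02 _ _ hk (by omega)).2 hadj
        · exact (h12 _ _ hk (by omega)).2 hadj
      · exact hpos b k hk0 hk _ (hgK l hl le_rfl) hadj
    rcases hPcase i hi with ⟨h1, h'⟩ | ⟨h1, h'⟩ | ⟨h1, h'', h'⟩ | ⟨h1, h'⟩ | ⟨h1, h'⟩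
    · exact absurd (h' ▸ h) (hpos' 0 _ (Or.inl rfl) (by omega) (by omega))
    · omega
    · omega
    · omega
    · exact absurd (h' ▸ h) (hpos' 1 _ (Or.inr rfl) (by omega) (by omega))

end ThreeLegs

/-! ### Independence bounds from star-freeness -/

/-- Every independent subset of `X` has at most `m` elements. -/
def AlphaLe {V : Type u} (G : SimpleGraph V) (X : Set V) (m : ℕ) : Prop :=
  ∀ I ⊆ X, G.IsIndepSet I → I.ncard ≤ m

/-- The closed neighbourhood of a set. -/
def closedNbhd {V : Type u} (G : SimpleGraph V) (Y : Set V) : Set V :=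
  {v | v ∈ Y ∨ ∃ u ∈ Y, G.Adj u v}

/-- `C` is a connected component of `G - X` containing more than half of `I`. -/
structure IsMajority {V : Type u} (G : SimpleGraph V) (I X C : Set V) : Prop where
  disj : ∀ x ∈ C, x ∉ X
  conn : ConnSet G C
  closed : ∀ x ∈ C, ∀ y, G.Adj x y → y ∈ C ∨ y ∈ X
  half : I.ncard < 2 * (I ∩ C).ncard

section Alpha

variable {V : Type u} {G : SimpleGraph V}

lemma AlphaLe.mono {X Y : Set V} {m n : ℕ} (h : AlphaLe G X m) (hY : Y ⊆ X) (hm : m ≤ n) :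
    AlphaLe G Y n :=
  fun I hI hind => (h I (hI.trans hY) hind).trans hm

lemma AlphaLe.union [Finite V] {X Y : Set V} {m n : ℕ} (hX : AlphaLe G X m) (hY : AlphaLe G Y n) :
    AlphaLe G (X ∪ Y) (m + n) := by
  intro I hI hind
  have h : I = (I ∩ X) ∪ (I ∩ Y) := by
    rw [← Set.inter_union_distrib_left, Set.inter_eq_left.2 hI]
  rw [h]
  exact (Set.ncard_union_le _ _).trans
    (add_le_add (hX _ Set.inter_subset_right (hind.mono Set.inter_subset_left))
      (hY _ Set.inter_subset_right (hind.mono Set.inter_subset_left)))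

lemma starGraphK_indContained {d : ℕ} (c : V) (f : Fin d → V) (hf : Function.Injective f)
    (hadj : ∀ i, G.Adj c (f i)) (hind : ∀ i j, ¬ G.Adj (f i) (f j)) : starGraphK d ⊴ G := by
  refine ⟨⟨⟨Sum.elim (fun _ => c) f, ?_⟩, ?_⟩⟩
  · rintro (i | i) (j | j) h
    · rw [Subsingleton.elim i j]
    · exact absurd (hadj j) (by simp only [Sum.elim_inl, Sum.elim_inr] at h; rw [← h]; exact G.irrefl)
    · exact absurd (hadj i) (by simp only [Sum.elim_inl, Sum.elim_inr] at h; rw [h]; exact G.irrefl)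
    · rw [hf h]
  · rintro (i | i) (j | j)
    · exact iff_of_false G.irrefl (by simp)
    · exact iff_of_true (hadj j) (by simp)
    · exact iff_of_true (hadj i).symm (by simp)
    · exact iff_of_false (hind i j) (by simp)

/-- An independent set through `v` is just `{v}`, which is where `0 < d` enters; one avoiding `v`
consists of neighbours of `v`, and `d` of them would form a star. -/
lemma alphaLe_closedNbhd_singleton [Finite V] {d : ℕ} (hd : 0 < d) (hK : IsFreeOf G (starGraphK d))
    (v : V) : AlphaLe G (closedNbhd G {v}) d := by
  intro I hI hind
  by_contra hlt
  by_cases hv : v ∈ I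
  · have : I ⊆ {v} := by
      intro x hx
      rcases hI hx with h | ⟨u, rfl, h⟩
      · exact h
      · by_contra hne
        exact hind hv hx (fun e => hne e.symm) h
    have := Set.ncard_le_ncard this
    rw [Set.ncard_singleton] at this
    omega
  · obtain ⟨J, hJI, hJ⟩ := Set.exists_subset_card_eq (show d ≤ I.ncard by omega)
    have hfin : Finite J := Set.toFinite J
    have e : J ≃ Fin d := Finite.equivFinOfCardEq hJ
    refine hK (starGraphK_indContained v (fun i => (e.symm i : V))
      (Subtype.val_injective.comp e.symm.injective) ?_ ?_)
    · intro i
      rcases hI (hJI (e.symm i).2) with h | ⟨u, rfl, h⟩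
      · exact absurd (hJI (e.symm i).2) (by rw [Set.mem_singleton_iff] at h; rwa [h])
      · exact h
    · intro i j h
      exact hind (hJI (e.symm i).2) (hJI (e.symm j).2) h.ne h

lemma alphaLe_closedNbhd [Finite V] {d : ℕ} (hd : 0 < d) (hK : IsFreeOf G (starGraphK d))
    (Y : Set V) : AlphaLe G (closedNbhd G Y) (d * Y.ncard) := by
  induction Y, Set.toFinite Y using Set.Finite.induction_on with
  | empty =>
    intro I hI _
    have : I = ∅ := Set.subset_empty_iff.1 fun x hx => by
      rcases hI hx with h | ⟨u, h, _⟩ <;> exact h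
    simp [this]
  | @insert a s ha hs ih =>
    rw [Set.ncard_insert_of_notMem ha hs]
    refine (ih.union (alphaLe_closedNbhd_singleton hd hK a)).mono ?_ (by ring_nf; rfl)
    rintro x ((rfl | h) | ⟨u, rfl | h, hux⟩)
    · exact Or.inr (Or.inl rfl)
    · exact Or.inl (Or.inl h)
    · exact Or.inr (Or.inr ⟨_, rfl, hux⟩)
    · exact Or.inl (Or.inr ⟨u, h, hux⟩)

/-- A vertex attached to a long induced path has, in a star-free graph, a pendant subpath. -/
lemma exists_pendant_subpath {d p : ℕ} (hK : IsFreeOf G (starGraphK d)) {f : ℕ → V}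
    (hf : IndPath G f (d * (p + 1))) {x : V} (hx : ∃ i < d * (p + 1), G.Adj x (f i)) :
    ∃ g : ℕ → V, IndPath G g (p + 1) ∧ (∀ k < p + 1, ∃ i < d * (p + 1), g k = f i) ∧
      G.Adj x (g 0) ∧ ∀ k, 1 ≤ k → k < p + 1 → ¬ G.Adj x (g k) := by
  classical
  -- Look for a window of `p` consecutive non-neighbours of `x`. The subpath starts at the last
  -- neighbour before the window or, failing that, at the first neighbour after it, and runs into
  -- the window.
  by_cases hgap : ∃ i, i + p ≤ d * (p + 1) ∧ ∀ k < p, ¬ G.Adj x (f (i + k))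
  · obtain ⟨i, hi, hik⟩ := hgap
    by_cases hleft : ∃ a < i, G.Adj x (f a)
    · obtain ⟨a, hai, hadj, hmax⟩ : ∃ a < i, G.Adj x (f a) ∧ ∀ b, a < b → b < i → ¬ G.Adj x (f b) := by
        let S := (Finset.range i).filter fun a => G.Adj x (f a)
        have hS : S.Nonempty := by
          obtain ⟨a, h1, h2⟩ := hleft
          exact ⟨a, by simp [S, h1, h2]⟩
        have h1 := S.max'_mem hS
        simp only [S, Finset.mem_filter, Finset.mem_range] at h1
        refine ⟨S.max' hS, h1.1, h1.2, fun b hb hbi h => ?_⟩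
        have := S.le_max' b (by simp [S, hbi, h])
        omega
      refine ⟨fun k => f (a + k), hf.shift a (by omega), fun k hk => ⟨a + k, by omega, rfl⟩, hadj, ?_⟩
      intro k hk0 hk h
      by_cases hki : a + k < i
      · exact hmax _ (by omega) hki h
      · refine hik (a + k - i) (by omega) ?_
        rwa [show i + (a + k - i) = a + k by omega]
    · obtain ⟨b, hb, hxb⟩ := hx
      have hge : ∀ a, G.Adj x (f a) → i + p ≤ a := by
        intro a h
        by_contra hlt
        by_cases hai : a < i
        · exact hleft ⟨a, hai, h⟩
        · exact hik (a - i) (by omega) (by rwa [show i + (a - i) = a by omega])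
      have hex : ∃ a, G.Adj x (f a) := ⟨b, hxb⟩
      have h1 := Nat.find_spec hex
      have h2 := Nat.find_min' hex hxb
      have h3 := hge _ h1
      have h4 : ∀ a, a < Nat.find hex → ¬ G.Adj x (f a) := fun a => Nat.find_min hex
      set a := Nat.find hex
      refine ⟨fun k => f (a - k), hf.rev a (by omega) (by omega),
        fun k hk => ⟨a - k, by omega, rfl⟩, h1, ?_⟩
      intro k hk0 hk
      exact h4 _ (by omega)
  · exfalso
    push Not at hgap
    -- Cut the path into `d` blocks of length `p + 1` and pick a neighbour of `x` among the first
    -- `p` vertices of each. The unused last vertex of a block keeps the picks non-adjacent, so they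
    -- form a star with `x`.
    have hblock : ∀ i : Fin d, ∃ k < p, G.Adj x (f (i * (p + 1) + k)) := by
      intro i
      apply hgap
      have h : ((i : ℕ) + 1) * (p + 1) ≤ d * (p + 1) := Nat.mul_le_mul_right _ i.2
      rw [add_mul] at h
      omega
    choose k hk hadj using hblock
    have hlt : ∀ i : Fin d, (i : ℕ) * (p + 1) + k i < d * (p + 1) := by
      intro i
      have h : ((i : ℕ) + 1) * (p + 1) ≤ d * (p + 1) := Nat.mul_le_mul_right _ i.2
      rw [add_mul] at h
      have := hk i
      omega
    have hsep : ∀ i j : Fin d, i < j → (i : ℕ) * (p + 1) + k i + 1 < j * (p + 1) + k j := by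
      intro i j hij
      have h : ((i : ℕ) + 1) * (p + 1) ≤ j * (p + 1) := Nat.mul_le_mul_right _ hij
      rw [add_mul] at h
      have := hk i
      omega
    refine hK (starGraphK_indContained x (fun i => f (i * (p + 1) + k i)) ?_ hadj ?_)
    · intro i j h
      have h' := hf.inj _ _ (hlt i) (hlt j) h
      rcases lt_trichotomy i j with hij | hij | hij
      · have := hsep i j hij; omega
      · exact hij
      · have := hsep j i hij; omega
    · intro i j h
      rw [hf.adj _ _ (hlt i) (hlt j)] at h
      rcases lt_trichotomy i j with hij | hij | hij
      · have := hsep i j hij; omega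
      · subst hij; omega
      · have := hsep j i hij; omega

end Alpha

/-! ### Majority components and the Gyárfás path -/

section Separators

variable {V : Type u} {G : SimpleGraph V}

lemma closedNbhd_mono {Y Z : Set V} (h : Y ⊆ Z) : closedNbhd G Y ⊆ closedNbhd G Z := by
  rintro x (hx | ⟨u, hu, hux⟩)
  · exact Or.inl (h hx)
  · exact Or.inr ⟨u, h hu, hux⟩

lemma closedNbhd_union (Y Z : Set V) :
    closedNbhd G (Y ∪ Z) = closedNbhd G Y ∪ closedNbhd G Z := by
  ext x
  simp only [closedNbhd, Set.mem_union, Set.mem_ofPred_eq]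
  constructor
  · rintro ((h | h) | ⟨u, h | h, hu⟩)
    exacts [Or.inl (Or.inl h), Or.inr (Or.inl h), Or.inl (Or.inr ⟨u, h, hu⟩),
      Or.inr (Or.inr ⟨u, h, hu⟩)]
  · rintro ((h | ⟨u, h, hu⟩) | (h | ⟨u, h, hu⟩))
    exacts [Or.inl (Or.inl h), Or.inr ⟨u, Or.inl h, hu⟩, Or.inl (Or.inr h),
      Or.inr ⟨u, Or.inr h, hu⟩]

lemma ConnSet.insert_of_adj {C : Set V} (hC : ConnSet G C) {x y : V} (hy : y ∈ C) (hxy : G.Adj x y) :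
    ConnSet G (insert x C) := by
  intro S hS hne hcl
  have hyS : y ∈ S := by
    obtain ⟨z, hz⟩ := hne
    rcases hS hz with rfl | hzC
    · exact hcl z hz y (Or.inr hy) hxy
    · have := hC (S ∩ C) Set.inter_subset_right ⟨z, hz, hzC⟩
        fun a ha b hb hab => ⟨hcl a ha.1 b (Or.inr hb) hab, hb⟩
      exact (this hy).1
  have hCS := hC (S ∩ C) Set.inter_subset_right ⟨y, hyS, hy⟩
    fun a ha b hb hab => ⟨hcl a ha.1 b (Or.inr hb) hab, hb⟩
  rintro z (rfl | hz)
  · exact hcl y hyS z (Or.inl rfl) hxy.symm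
  · exact (hCS hz).1

/-- A connected set extends to a connected component of `U`. -/
lemma ConnSet.exists_component [Finite V] {C U : Set V} (hC : ConnSet G C)
    (hCU : C ⊆ U) : ∃ C', C ⊆ C' ∧ C' ⊆ U ∧ ConnSet G C' ∧
      ∀ x ∈ C', ∀ y ∈ U, G.Adj x y → y ∈ C' := by
  obtain ⟨C', hCC', hmax⟩ := Set.Finite.exists_le_maximal
    (Set.toFinite {D : Set V | C ⊆ D ∧ D ⊆ U ∧ ConnSet G D}) (a := C) ⟨subset_rfl, hCU, hC⟩
  refine ⟨C', hCC', hmax.prop.2.1, hmax.prop.2.2, fun x hx y hy hxy => ?_⟩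
  refine hmax.le_of_ge (y := insert y C') ⟨hCC'.trans (Set.subset_insert _ _), ?_, ?_⟩
    (Set.subset_insert _ _) (Set.mem_insert _ _)
  · exact Set.insert_subset hy hmax.prop.2.1
  · exact hmax.prop.2.2.insert_of_adj hx hxy.symm

/-- Both sets contain more than half of `I`, so they meet. The connected set `C'` avoids `X`, and
`C` can only be left through `X`, so `C'` never leaves `C`. -/
lemma IsMajority.subset [Finite V] {I X X' C C' : Set V} (h : IsMajority G I X C)
    (h' : IsMajority G I X' C') (hX : X ⊆ X') : C' ⊆ C := by
  have hne : (C' ∩ C).Nonempty := by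
    by_contra hemp
    rw [Set.not_nonempty_iff_eq_empty, ← Set.disjoint_iff_inter_eq_empty] at hemp
    have h1 := h.half
    have h2 := h'.half
    have h3 : Disjoint (I ∩ C) (I ∩ C') :=
      (hemp.symm.mono Set.inter_subset_right Set.inter_subset_right)
    have h4 := Set.ncard_union_eq h3
    have h5 : (I ∩ C ∪ I ∩ C').ncard ≤ I.ncard :=
      Set.ncard_le_ncard (Set.union_subset Set.inter_subset_left Set.inter_subset_left)
    omega
  refine (h'.conn (C' ∩ C) Set.inter_subset_left hne ?_).trans Set.inter_subset_right
  intro x hx y hy hxy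
  exact ⟨hy, (h.closed x hx.2 y hxy).resolve_right fun hyX => h'.disj y hy (hX hyX)⟩

lemma exists_isMajority [Finite V] {I X : Set V}
    (h : ¬ ∀ C, (∀ x ∈ C, x ∉ X) → ConnSet G C → 2 * (I ∩ C).ncard ≤ I.ncard) :
    ∃ C, IsMajority G I X C := by
  push Not at h
  obtain ⟨C, hCX, hC, hI⟩ := h
  obtain ⟨C', hCC', hU, hconn, hcl⟩ := hC.exists_component (U := Xᶜ) hCX
  refine ⟨C', fun x hx => hU hx, hconn, fun x hx y hxy => ?_, hI.trans_le ?_⟩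
  · by_cases hy : y ∈ X
    · exact Or.inr hy
    · exact Or.inl (hcl x hx y hy hxy)
  · have : (I ∩ C).ncard ≤ (I ∩ C').ncard :=
      Set.ncard_le_ncard (Set.inter_subset_inter_right _ hCC')
    omega

/-- If no closed neighbourhood of `Y` together with fewer than `n` further vertices is a balanced
separator, then the majority component beyond `Y` contains an induced path with `n` vertices. -/
lemma IsMajority.exists_indPath [Finite V] {I Y B : Set V} (hB : IsMajority G I (closedNbhd G Y) B)
    (n : ℕ) (hn : 0 < n) (hbad : ∀ Q : Set V, Q.ncard < n →
      ∃ C, IsMajority G I (closedNbhd G (Y ∪ Q)) C) :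
    ∃ f : ℕ → V, IndPath G f n ∧ ∀ i < n, f i ∈ B := by
  -- Invariant: the neighbourhoods of all path vertices except the last `f m` have been removed, and
  -- the current majority component still meets the closed neighbourhood of `f m`.
  suffices h : ∀ m, m < n → ∃ f : ℕ → V, IndPath G f (m + 1) ∧ (∀ i < m + 1, f i ∈ B) ∧
      ∃ C, IsMajority G I (closedNbhd G (Y ∪ f '' Set.Iio m)) C ∧ C ⊆ B ∧
        (C ∩ closedNbhd G {f m}).Nonempty by
    obtain ⟨f, hf, hfB, -⟩ := h (n - 1) (by omega)
    rw [Nat.sub_add_cancel hn] at hf hfB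
    exact ⟨f, hf, hfB⟩
  intro m
  induction m with
  | zero =>
    intro _
    have hne : B.Nonempty := by
      by_contra hemp
      rw [Set.not_nonempty_iff_eq_empty] at hemp
      have := hB.half
      simp [hemp] at this
    obtain ⟨b, hb⟩ := hne
    refine ⟨fun _ => b, ⟨by intros; omega, ?_⟩, fun _ _ => hb, B, ?_, subset_rfl, b, hb, Or.inl rfl⟩
    · intro i j hi hj
      exact iff_of_false G.irrefl (by omega)
    · have : (fun _ : ℕ => b) '' Set.Iio 0 = ∅ := by
        rw [Set.image_eq_empty]; ext; simp
      rwa [this, Set.union_empty]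
  | succ m ih =>
    intro hm
    obtain ⟨f, hf, hfB, C, hC, hCB, z, hzC, hz⟩ := ih (by omega)
    have hQ : f '' Set.Iio (m + 1) = f '' Set.Iio m ∪ {f m} := by
      ext y
      simp only [Set.mem_image, Set.mem_Iio, Set.mem_union, Set.mem_singleton_iff]
      constructor
      · rintro ⟨i, hi, rfl⟩
        rcases Nat.lt_succ_iff_lt_or_eq.1 hi with h | rfl
        · exact Or.inl ⟨i, h, rfl⟩
        · exact Or.inr rfl
      · rintro (⟨i, hi, rfl⟩ | rfl)
        · exact ⟨i, by omega, rfl⟩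
        · exact ⟨m, by omega, rfl⟩
    obtain ⟨C', hC'⟩ := hbad (f '' Set.Iio (m + 1)) (by
      refine (Set.ncard_image_le (Set.finite_Iio _)).trans_lt ?_
      rw [Set.ncard_eq_toFinset_card']
      simpa using hm)
    have hsplit : closedNbhd G (Y ∪ f '' Set.Iio (m + 1)) =
        closedNbhd G (Y ∪ f '' Set.Iio m) ∪ closedNbhd G {f m} := by
      rw [hQ, ← Set.union_assoc, closedNbhd_union]
    have hC'C : C' ⊆ C := hC.subset hC' (hsplit ▸ Set.subset_union_left)
    have hzC' : z ∉ C' := fun h => hC'.disj z h (hsplit ▸ Or.inr hz)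
    have hne : C'.Nonempty := by
      by_contra hemp
      rw [Set.not_nonempty_iff_eq_empty] at hemp
      have := hC'.half
      simp [hemp] at this
    -- The new component is a proper subset of the connected old one, so an edge `xy` leaves it
    -- inside `C`. Then `y` was removed only because of `f m`, which makes it the next path vertex,
    -- and `x` preserves the invariant.
    obtain ⟨x, hx, y, hyC, hxy, hyC'⟩ : ∃ x ∈ C', ∃ y ∈ C, G.Adj x y ∧ y ∉ C' := by
      by_contra hcon
      push Not at hcon
      exact hzC' (hC.conn C' hC'C hne hcon hzC)
    have hyX := (hC'.closed x hx y hxy).resolve_left hyC'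
    have hyY := hC.disj y hyC
    rw [hsplit] at hyX
    have hym := hyX.resolve_left hyY
    have hxX := hC'.disj x hx
    rw [hsplit] at hxX
    have hfy : G.Adj (f m) y := by
      rcases hym with h | ⟨u, rfl, h⟩
      · rw [Set.mem_singleton_iff] at h
        exact absurd (Or.inr (Or.inr ⟨f m, rfl, h ▸ hxy.symm⟩)) hxX
      · exact h
    have hold : ∀ i < m, f i ≠ y ∧ ¬ G.Adj (f i) y := by
      intro i hi
      exact ⟨fun e => hyY (Or.inl (Or.inr ⟨i, hi, e⟩)),
        fun e => hyY (Or.inr ⟨f i, Or.inr ⟨i, hi, rfl⟩, e⟩)⟩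
    have happ : IndPath G (fun i => if i < m + 1 then f i else y) (m + 1 + 1) := by
      refine hf.append (g := fun _ => y) ⟨by intros; omega, ?_⟩ ?_ ?_
      · intro i j hi hj
        exact iff_of_false G.irrefl (by omega)
      · intro i j hi hj
        rcases Nat.lt_succ_iff_lt_or_eq.1 hi with h | rfl
        · exact (hold i h).1
        · exact hfy.ne
      · intro i j hi hj
        rcases Nat.lt_succ_iff_lt_or_eq.1 hi with h | rfl
        · exact iff_of_false (hold i h).2 (by omega)
        · exact iff_of_true hfy ⟨rfl, by omega⟩
    refine ⟨_, happ, ?_, C', ?_, hC'C.trans hCB, x, hx, ?_⟩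
    · intro i hi
      split_ifs with h
      · exact hfB i h
      · exact hCB hyC
    · have : (fun i => if i < m + 1 then f i else y) '' Set.Iio (m + 1) = f '' Set.Iio (m + 1) :=
        Set.image_congr fun i hi => if_pos hi
      rwa [this]
    · refine Or.inr ⟨_, rfl, ?_⟩
      simpa using hxy.symm

end Separators

/-! ### The balanced separator theorem -/

section SeparatorTheorem

variable {V : Type u} {G : SimpleGraph V}

/-- The empty set or the vertex set of an induced path with `n` vertices. -/
def IsLeg (G : SimpleGraph V) (n : ℕ) (Y : Set V) : Prop :=
  Y = ∅ ∨ ∃ f, IndPath G f n ∧ Y = f '' Set.Iio n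

lemma IsLeg.ncard_le {n : ℕ} {Y : Set V} (h : IsLeg G n Y) : Y.ncard ≤ n := by
  rcases h with rfl | ⟨f, -, rfl⟩
  · simp
  · refine (Set.ncard_image_le (Set.finite_Iio _)).trans ?_
    rw [Set.ncard_eq_toFinset_card']
    simp

/-- A star-free graph without the long claw and its line graph has, for every vertex set `I`, a
balanced separator of small independence number. -/
theorem exists_balanced_separator [Finite V] {d p : ℕ} (hd : 0 < d)
    (hK : IsFreeOf G (starGraphK d)) (hS : IsFreeOf G (subdividedClaw p))
    (hT : IsFreeOf G (lineSubdividedClaw p)) (I : Set V) :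
    ∃ X : Set V, AlphaLe G X (d * (3 * (d * (p + 1)))) ∧
      ∀ C, (∀ x ∈ C, x ∉ X) → ConnSet G C → 2 * (I ∩ C).ncard ≤ I.ncard := by
  by_contra hcon
  push Not at hcon
  set n := d * (p + 1) with hn
  have hn0 : 0 < n := by positivity
  have hbad : ∀ Y : Set V, Y.ncard ≤ 3 * n → ∃ C, IsMajority G I (closedNbhd G Y) C := by
    intro Y hY
    apply exists_isMajority
    push Not
    exact hcon _ ((alphaLe_closedNbhd hd hK Y).mono subset_rfl (Nat.mul_le_mul_left _ hY))
  -- a minimal majority component beyond two anticomplete legs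
  let 𝓑 : Set (Set V) := {B | ∃ Y Z, IsLeg G n Y ∧ IsLeg G n Z ∧ (∀ z ∈ Z, z ∉ closedNbhd G Y) ∧
    IsMajority G I (closedNbhd G (Y ∪ Z)) B}
  have h𝓑 : 𝓑.Nonempty := by
    obtain ⟨C, hC⟩ := hbad (∅ ∪ ∅) (by simp)
    exact ⟨C, ∅, ∅, Or.inl rfl, Or.inl rfl, by simp, hC⟩
  obtain ⟨B, hBmin⟩ := (Set.toFinite 𝓑).exists_minimal h𝓑
  obtain ⟨Y₀, Y₁, hY₀, hY₁, h01, hB⟩ := hBmin.prop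
  obtain ⟨f, hf, hfB⟩ := hB.exists_indPath n hn0 (by
    intro Q hQ
    apply hbad
    have h1 := Set.ncard_union_le (Y₀ ∪ Y₁) Q
    have h2 := Set.ncard_union_le Y₀ Y₁
    have h3 := hY₀.ncard_le
    have h4 := hY₁.ncard_le
    omega)
  set Y₂ := f '' Set.Iio n with hY₂def
  have hY₂ : IsLeg G n Y₂ := Or.inr ⟨f, hf, rfl⟩
  have hfar : ∀ y ∈ Y₂, y ∉ closedNbhd G Y₀ ∧ y ∉ closedNbhd G Y₁ := by
    rintro _ ⟨i, hi, rfl⟩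
    have := hB.disj _ (hfB i hi)
    rw [closedNbhd_union] at this
    exact ⟨fun h => this (Or.inl h), fun h => this (Or.inr h)⟩
  obtain ⟨D, hD⟩ := hbad (Y₀ ∪ Y₁ ∪ Y₂) (by
    have h1 := Set.ncard_union_le (Y₀ ∪ Y₁) Y₂
    have h2 := Set.ncard_union_le Y₀ Y₁
    have h3 := hY₀.ncard_le
    have h4 := hY₁.ncard_le
    have h5 := hY₂.ncard_le
    omega)
  have hDB : D ⊆ B := hB.subset hD (closedNbhd_mono Set.subset_union_left)
  have hf0D : f 0 ∉ D := fun h => hD.disj _ h (Or.inl (Or.inr ⟨0, hn0, rfl⟩))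
  -- Otherwise every outside neighbour of `D` lies in `N[Y ∪ Z]`, so `D` would be a majority
  -- component beyond these two legs alone. Minimality then gives `B ⊆ D`, although `f 0 ∈ B \ D`.
  have hattach : ∀ Y Z, IsLeg G n Y → IsLeg G n Z → (∀ z ∈ Z, z ∉ closedNbhd G Y) →
      Y ∪ Z ⊆ Y₀ ∪ Y₁ ∪ Y₂ →
      ∃ x, x ∉ D ∧ (∃ b ∈ D, G.Adj x b) ∧ x ∉ closedNbhd G Y ∧ x ∉ closedNbhd G Z := by
    intro Y Z hY hZ hYZ hsub
    by_contra hno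
    push Not at hno
    have hmaj : IsMajority G I (closedNbhd G (Y ∪ Z)) D := by
      refine ⟨fun x hx h => hD.disj x hx (closedNbhd_mono hsub h), hD.conn, ?_, hD.half⟩
      intro b hb x hbx
      by_cases hx : x ∈ D
      · exact Or.inl hx
      · right
        rw [closedNbhd_union]
        by_cases hxY : x ∈ closedNbhd G Y
        · exact Or.inl hxY
        · exact Or.inr (hno x hx ⟨b, hb, hbx.symm⟩ hxY)
    exact hf0D (hBmin.le_of_le ⟨Y, Z, hY, hZ, hYZ, hmaj⟩ hDB (hfB 0 hn0))
  let Y : Fin 3 → Set V := ![Y₀, Y₁, Y₂]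
  have hYleg : ∀ i, IsLeg G n (Y i) := by
    intro i; fin_cases i
    exacts [hY₀, hY₁, hY₂]
  have hYU : ∀ i, Y i ⊆ Y₀ ∪ Y₁ ∪ Y₂ := by
    intro i; fin_cases i
    exacts [fun x h => Or.inl (Or.inl h), fun x h => Or.inl (Or.inr h), fun x h => Or.inr h]
  have hYD : ∀ i, ∀ x ∈ D, x ∉ closedNbhd G (Y i) :=
    fun i x hx h => hD.disj x hx (closedNbhd_mono (hYU i) h)
  have hYfar : ∀ i j, i ≠ j → ∀ y ∈ Y i, ∀ z ∈ Y j, y ≠ z ∧ ¬ G.Adj y z := by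
    refine forall_fin_three_ne (fun i j h y hy z hz => ?_) ?_ ?_ ?_
    · exact ⟨(h z hz y hy).1.symm, fun e => (h z hz y hy).2 e.symm⟩
    · exact fun y hy z hz => ⟨fun e => h01 z hz (Or.inl (e ▸ hy)),
        fun e => h01 z hz (Or.inr ⟨y, hy, e⟩)⟩
    · exact fun y hy z hz => ⟨fun e => (hfar z hz).1 (Or.inl (e ▸ hy)),
        fun e => (hfar z hz).1 (Or.inr ⟨y, hy, e⟩)⟩
    · exact fun y hy z hz => ⟨fun e => (hfar z hz).2 (Or.inl (e ▸ hy)),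
        fun e => (hfar z hz).2 (Or.inr ⟨y, hy, e⟩)⟩
  have hx : ∀ i, ∃ x, x ∉ D ∧ (∃ b ∈ D, G.Adj x b) ∧ ∀ j, j ≠ i → x ∉ closedNbhd G (Y j) := by
    have key : ∀ i j k : Fin 3, j ≠ k → (∀ l, l ≠ i → l = j ∨ l = k) →
        ∃ x, x ∉ D ∧ (∃ b ∈ D, G.Adj x b) ∧ ∀ j, j ≠ i → x ∉ closedNbhd G (Y j) := by
      intro i j k hjk hcases
      obtain ⟨x, h1, h2, h3, h4⟩ := hattach (Y j) (Y k) (hYleg j) (hYleg k) (by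
        rintro z hz (h | ⟨u, hu, huz⟩)
        · exact (hYfar j k hjk z h z hz).1 rfl
        · exact (hYfar j k hjk u hu z hz).2 huz) (Set.union_subset (hYU j) (hYU k))
      refine ⟨x, h1, h2, fun l hl => ?_⟩
      rcases hcases l hl with rfl | rfl
      exacts [h3, h4]
    intro i
    fin_cases i
    · exact key 0 1 2 (by decide) (by decide)
    · exact key 1 0 2 (by decide) (by decide)
    · exact key 2 0 1 (by decide) (by decide)
  choose x hxD hxb hxY using hx
  have hxi : ∀ i, x i ∉ Y i ∧ ∃ y ∈ Y i, G.Adj (x i) y := by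
    intro i
    obtain ⟨b, hb, hxb'⟩ := hxb i
    have h1 : x i ∉ Y i := fun h => hYD i b hb (Or.inr ⟨x i, h, hxb'⟩)
    refine ⟨h1, ?_⟩
    have h2 := (hD.closed b hb (x i) hxb'.symm).resolve_left (hxD i)
    -- As a neighbour of `D` outside `D`, `x i` lies in the closed neighbourhood of some leg, and
    -- only the `i`-th is left. In particular that leg is nonempty.
    have h3 : x i ∈ closedNbhd G (Y i) := by
      by_contra hno
      have hall : ∀ j, x i ∉ closedNbhd G (Y j) := fun j => by
        by_cases hj : j = i
        · exact hj ▸ hno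
        · exact hxY i j hj
      rw [closedNbhd_union, closedNbhd_union] at h2
      rcases h2 with (h2 | h2) | h2
      exacts [hall 0 h2, hall 1 h2, hall 2 h2]
    rcases h3 with h3 | ⟨u, hu, hux⟩
    · exact absurd h3 h1
    · exact ⟨u, hu, hux.symm⟩
  have hg : ∀ i, ∃ g : ℕ → V, IndPath G g (p + 1) ∧ (∀ k < p + 1, g k ∈ Y i) ∧
      G.Adj (x i) (g 0) ∧ ∀ k, 1 ≤ k → k < p + 1 → ¬ G.Adj (x i) (g k) := by
    intro i
    obtain ⟨-, y, hy, hxy⟩ := hxi i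
    rcases hYleg i with h | ⟨q, hq, hYq⟩
    · rw [h] at hy; exact hy.elim
    · obtain ⟨a, ha, rfl⟩ : y ∈ q '' Set.Iio n := hYq ▸ hy
      obtain ⟨g, h1, h2, h3, h4⟩ := exists_pendant_subpath hK hq ⟨a, ha, hxy⟩
      refine ⟨g, h1, fun k hk => ?_, h3, h4⟩
      obtain ⟨b, hb, e⟩ := h2 k hk
      rw [hYq, e]
      exact ⟨b, hb, rfl⟩
  choose g hgpath hgY hg0 hgpos using hg
  obtain ⟨b₀, hb₀, hx₀⟩ := hxb 0
  obtain ⟨b₁, hb₁, hx₁⟩ := hxb 1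
  obtain ⟨b₂, hb₂, hx₂⟩ := hxb 2
  have hKconn : ConnSet G (insert (x 0) (insert (x 1) (insert (x 2) D))) :=
    ((hD.conn.insert_of_adj hb₂ hx₂).insert_of_adj (Or.inr hb₁) hx₁).insert_of_adj
      (Or.inr (Or.inr hb₀)) hx₀
  have hKmem : ∀ y, y ∈ insert (x 0) (insert (x 1) (insert (x 2) D)) ↔ (∃ i, y = x i) ∨ y ∈ D := by
    intro y
    simp only [Set.mem_insert_iff, Fin.exists_fin_succ, or_assoc]
    simp
  refine (claw_or_line_of_three_legs hKconn g hgpath ?_ ?_ ?_ ?_).elim hS hT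
  · intro i j hij k l hk hl
    exact hYfar i j hij _ (hgY i k hk) _ (hgY j l hl)
  · intro i k hk h
    rcases (hKmem _).1 h with ⟨j, e⟩ | h
    · by_cases hj : i = j
      · subst hj
        exact (hxi i).1 (e ▸ hgY i k hk)
      · exact hxY j i hj (Or.inl (e ▸ hgY i k hk))
    · exact hYD i _ h (Or.inl (hgY i k hk))
  · intro i
    exact ⟨x i, (hKmem _).2 (Or.inl ⟨i, rfl⟩), (hg0 i).symm⟩
  · intro i k hk0 hk y hy h
    rcases (hKmem _).1 hy with ⟨j, rfl⟩ | hy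
    · by_cases hj : i = j
      · subst hj
        exact hgpos i k hk0 hk h.symm
      · exact hxY j i hj (Or.inr ⟨_, hgY i k hk, h⟩)
    · exact hYD i y hy (Or.inr ⟨_, hgY i k hk, h⟩)

end SeparatorTheorem

/-! ### Attaching a leaf to a tree; connected vertex sets -/

section PendantVertex

/-- The graph `T` with a pendant vertex `none` attached at `t₀`. -/
def pendantGraph {N : Type u} (T : SimpleGraph N) (t₀ : N) : SimpleGraph (Option N) where
  Adj x y :=
    match x, y with
    | none, none => False
    | none, some b => b = t₀
    | some a, none => a = t₀
    | some a, some b => T.Adj a b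
  symm := ⟨by
    rintro (_ | a) (_ | b) h
    exacts [h, h, h, T.adj_symm h]⟩
  loopless := ⟨by
    rintro (_ | a) h
    exacts [h, T.irrefl h]⟩

lemma pendantGraph_isTree {N : Type u} [Finite N] {T : SimpleGraph N} (hT : T.IsTree) (t₀ : N) :
    (pendantGraph T t₀).IsTree := by
  rw [SimpleGraph.isTree_iff_connected_and_card]
  refine ⟨?_, ?_⟩
  · let φ : T →g pendantGraph T t₀ := ⟨some, fun h => h⟩
    have h : ∀ x, (pendantGraph T t₀).Reachable none x := by
      have h0 : (pendantGraph T t₀).Adj none (some t₀) := rfl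
      rintro (_ | a)
      · exact SimpleGraph.Reachable.refl _
      · exact h0.reachable.trans ((hT.connected t₀ a).map φ)
    have : Nonempty (Option N) := ⟨none⟩
    exact ⟨fun x y => (h x).symm.trans (h y)⟩
  · have h := (SimpleGraph.isTree_iff_connected_and_card.1 hT).2
    rw [Finite.card_option, ← h, add_left_inj, Nat.card_coe_set_eq, Nat.card_coe_set_eq]
    have he : (pendantGraph T t₀).edgeSet =
        insert s(none, some t₀) (Sym2.map some '' T.edgeSet) := by
      ext e
      induction e with | _ x y
      simp only [SimpleGraph.mem_edgeSet, Set.mem_insert_iff, Set.mem_image]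
      constructor
      · intro hxy
        rcases x with _ | a <;> rcases y with _ | b
        · exact hxy.elim
        · obtain rfl : b = t₀ := hxy
          exact Or.inl rfl
        · obtain rfl : a = t₀ := hxy
          exact Or.inl Sym2.eq_swap
        · exact Or.inr ⟨s(a, b), hxy, rfl⟩
      · rintro (hxy | ⟨e, he, hxy⟩)
        · rw [Sym2.eq_iff] at hxy
          rcases hxy with ⟨rfl, rfl⟩ | ⟨rfl, rfl⟩ <;> rfl
        · induction e with | _ a b
          rw [Sym2.map_mk, Sym2.eq_iff] at hxy
          rcases hxy with ⟨rfl, rfl⟩ | ⟨rfl, rfl⟩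
          exacts [he, T.adj_symm he]
    rw [he, Set.ncard_insert_of_notMem _ (Set.toFinite _),
      Set.ncard_image_of_injective _ (Sym2.map.injective (Option.some_injective _))]
    rintro ⟨e, -, h⟩
    induction e with | _ a b
    rw [Sym2.map_mk, Sym2.eq_iff] at h
    simp at h

lemma ConnSet.image_some {N : Type u} {T : SimpleGraph N} {t₀ : N} {S : Set N} (hS : ConnSet T S) :
    ConnSet (pendantGraph T t₀) (some '' S) := by
  intro R hR hne hcl
  have := hS (some ⁻¹' R) (fun a ha => by
    obtain ⟨b, hb, h⟩ := hR ha
    rwa [← Option.some.inj h]) (by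
    obtain ⟨x, hx⟩ := hne
    obtain ⟨a, -, rfl⟩ := hR hx
    exact ⟨a, hx⟩) (fun a ha b hb hab => hcl (some a) ha (some b) ⟨b, hb, rfl⟩ hab)
  rintro _ ⟨a, ha, rfl⟩
  exact this ha

lemma connSet_singleton {N : Type u} (T : SimpleGraph N) (t : N) : ConnSet T {t} := by
  rintro S hS ⟨x, hx⟩ -
  obtain rfl : x = t := hS hx
  rintro _ rfl
  exact hx

lemma ConnSet.connected_induce {N : Type u} {T : SimpleGraph N} {S : Set N} (hS : ConnSet T S)
    (hne : S.Nonempty) : (T.induce S).Connected := by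
  have : Nonempty S := hne.to_subtype
  refine ⟨fun x y => ?_⟩
  have := hS {z | ∃ hz : z ∈ S, (T.induce S).Reachable x ⟨z, hz⟩} (fun z hz => hz.1)
    ⟨x, x.2, SimpleGraph.Reachable.refl _⟩ (by
      rintro a ⟨ha, hxa⟩ b hb hab
      refine ⟨hb, hxa.trans (SimpleGraph.Adj.reachable ?_)⟩
      exact hab)
  obtain ⟨_, h⟩ := this y.2
  exact h

lemma connSet_univ {N : Type u} {T : SimpleGraph N} (hT : T.Preconnected) : ConnSet T Set.univ := by
  rintro S - ⟨x, hx⟩ hcl y -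
  obtain ⟨p⟩ := hT x y
  induction p with
  | nil => exact hx
  | cons h p ih => exact ih (hcl _ hx _ trivial h)

end PendantVertex

/-! ### From balanced separators to tree decompositions -/

section Decompositions

variable {V : Type u} {G : SimpleGraph V}

/-- `U` is decomposed by the family `ℬ` of bags of independence number at most `m`, built by
adding one leaf bag at a time. -/
inductive LeafDecomposition (G : SimpleGraph V) (m : ℕ) : Set V → Set (Set V) → Prop
  | single (B : Set V) : AlphaLe G B m → LeafDecomposition G m B {B}
  | leaf {U : Set V} {ℬ : Set (Set V)} (B B' : Set V) : LeafDecomposition G m U ℬ → B' ∈ ℬ →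
      U ∩ B ⊆ B' → (∀ x ∈ U, ∀ y ∈ B, G.Adj x y → x ∈ B ∨ y ∈ U) → AlphaLe G B m →
      LeafDecomposition G m (U ∪ B) (insert B ℬ)

lemma LeafDecomposition.subset {m : ℕ} {U : Set V} {ℬ : Set (Set V)}
    (h : LeafDecomposition G m U ℬ) : ∀ B ∈ ℬ, B ⊆ U := by
  induction h with
  | single B hB => rintro _ rfl; exact subset_rfl
  | leaf B B' _ _ _ _ _ ih =>
    rintro C (rfl | hC)
    · exact Set.subset_union_right
    · exact (ih C hC).trans Set.subset_union_left

/-- Each new bag becomes a pendant node at the node of `B'`. A vertex of `B` already in `U` lies in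
`B'`, so its node set stays connected. Starting from `Unit` and iterating `Option` keeps the nodes
in `Type`; `ConnSet` admits the empty node set of vertices not yet covered. -/
lemma LeafDecomposition.exists_tree {m : ℕ} {U : Set V} {ℬ : Set (Set V)}
    (h : LeafDecomposition G m U ℬ) :
    ∃ (N : Type) (_ : Finite N) (T : SimpleGraph N) (bag : N → Set V), T.IsTree ∧
      (∀ B ∈ ℬ, ∃ t, bag t = B) ∧ (∀ t, AlphaLe G (bag t) m) ∧ (∀ v, v ∈ U ↔ ∃ t, v ∈ bag t) ∧
      (∀ x ∈ U, ∀ y ∈ U, G.Adj x y → ∃ t, x ∈ bag t ∧ y ∈ bag t) ∧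
      ∀ v, ConnSet T {t | v ∈ bag t} := by
  induction h with
  | single B hB =>
    refine ⟨Unit, inferInstance, ⊥, fun _ => B, SimpleGraph.IsTree.of_subsingleton, ?_, fun _ => hB,
      fun v => by simp, fun x hx y hy _ => ⟨(), hx, hy⟩, ?_⟩
    · rintro _ rfl
      exact ⟨(), rfl⟩
    · intro v S hS hne _ t _
      obtain ⟨s, hs⟩ := hne
      exact hs
  | @leaf U ℬ B B' _ hB' hUB hedge hB ih =>
    obtain ⟨N, hN, T, bag, hT, hbag, hα, hU, hE, hconn⟩ := ih
    obtain ⟨t₀, ht₀⟩ := hbag B' hB'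
    refine ⟨Option N, inferInstance, pendantGraph T t₀, fun t => t.elim B bag,
      pendantGraph_isTree hT t₀, ?_, ?_, ?_, ?_, ?_⟩
    · rintro C (rfl | hC)
      · exact ⟨none, rfl⟩
      · obtain ⟨t, rfl⟩ := hbag C hC
        exact ⟨some t, rfl⟩
    · rintro (_ | t)
      exacts [hB, hα t]
    · intro v
      constructor
      · rintro (hv | hv)
        · obtain ⟨t, ht⟩ := (hU v).1 hv
          exact ⟨some t, ht⟩
        · exact ⟨none, hv⟩
      · rintro ⟨_ | t, ht⟩
        · exact Or.inr ht
        · exact Or.inl ((hU v).2 ⟨t, ht⟩)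
    · have key : ∀ x ∈ U, ∀ y ∈ U, G.Adj x y →
          ∃ t : Option N, x ∈ t.elim B bag ∧ y ∈ t.elim B bag := by
        intro x hx y hy hxy
        obtain ⟨t, ht⟩ := hE x hx y hy hxy
        exact ⟨some t, ht⟩
      rintro x (hx | hx) y (hy | hy) hxy
      · exact key x hx y hy hxy
      · rcases hedge x hx y hy hxy with h | h
        exacts [⟨none, h, hy⟩, key x hx y h hxy]
      · rcases hedge y hy x hx hxy.symm with h | h
        exacts [⟨none, hx, h⟩, key x h y hy hxy]
      · exact ⟨none, hx, hy⟩
    · intro v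
      have hset : {t : Option N | v ∈ t.elim B bag} =
          {t | t = none ∧ v ∈ B} ∪ some '' {t | v ∈ bag t} := by
        ext t
        rcases t with _ | t <;> simp
      rw [hset]
      by_cases hv : v ∈ B
      · have h1 : {t : Option N | t = none ∧ v ∈ B} = {none} := by ext; simp [hv]
        rw [h1, Set.singleton_union]
        by_cases hvU : v ∈ U
        · refine (hconn v).image_some.insert_of_adj (y := some t₀) ⟨t₀, ?_, rfl⟩ rfl
          show v ∈ bag t₀
          exact ht₀ ▸ hUB ⟨hvU, hv⟩
        · have h2 : {t | v ∈ bag t} = ∅ := by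
            ext t
            exact iff_of_false (fun h => hvU ((hU v).2 ⟨t, h⟩)) (fun h => h)
          rw [h2, Set.image_empty, insert_empty_eq]
          exact connSet_singleton _ _
      · have h1 : {t : Option N | t = none ∧ v ∈ B} = ∅ := by ext; simp [hv]
        rw [h1, Set.empty_union]
        exact (hconn v).image_some

/-- If every vertex set has a balanced separator of independence number at most `c`, then any
partial decomposition can be extended to a set `U` meeting it in a subset `W` of a bag. -/
lemma LeafDecomposition.extend [Finite V] {c : ℕ} (hc : 0 < c)
    (hsep : ∀ I : Set V, ∃ X : Set V, AlphaLe G X c ∧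
      ∀ C, (∀ x ∈ C, x ∉ X) → ConnSet G C → 2 * (I ∩ C).ncard ≤ I.ncard) (n : ℕ) :
    ∀ U W : Set V, U.ncard + (U \ W).ncard ≤ n → W ⊆ U → AlphaLe G W (4 * c) →
      ∀ U₀ ℬ, LeafDecomposition G (5 * c) U₀ ℬ → (∃ B ∈ ℬ, W ⊆ B) → U ∩ U₀ ⊆ W →
        (∀ x ∈ U, ∀ y ∈ U₀, G.Adj x y → x ∈ W ∨ y ∈ W) →
        ∃ ℬ', ℬ ⊆ ℬ' ∧ LeafDecomposition G (5 * c) (U₀ ∪ U) ℬ' := by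
  -- The measure is $|U|+|U\setminus W|$: enlarging `W` lowers the second term, while passing from
  -- `U` to `C ∪ X` lowers the first without raising the second.
  induction n with
  | zero =>
    rintro U W hn hWU hW U₀ ℬ hdec - - -
    have : U = ∅ := by
      rw [← Set.ncard_eq_zero]; omega
    exact ⟨ℬ, subset_rfl, by rwa [this, Set.union_empty]⟩
  | succ n ih =>
    rintro U W hn hWU hW U₀ ℬ hdec ⟨B, hB, hWB⟩ hUU₀ hedge
    by_cases hUW : U ⊆ W
    · refine ⟨ℬ, subset_rfl, ?_⟩
      rwa [Set.union_eq_left.2 ((hUW.trans hWB).trans (hdec.subset B hB))]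
    obtain ⟨v, hvU, hvW⟩ := Set.not_subset.1 hUW
    have hWU₀ : W ⊆ U₀ := hWB.trans (hdec.subset B hB)
    by_cases hv : AlphaLe G (insert v W) (4 * c)
    · -- the boundary can grow by one vertex
      have hdec' := LeafDecomposition.leaf (insert v W) B hdec hB (by
          rintro x ⟨hx0, rfl | hx⟩
          · exact absurd (hUU₀ ⟨hvU, hx0⟩) hvW
          · exact hWB hx) (by
          rintro x hx y (rfl | hy) hxy
          · exact Or.inl (Or.inr ((hedge y hvU x hx hxy.symm).resolve_left hvW))
          · exact Or.inr (hWU₀ hy)) (hv.mono subset_rfl (by omega))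
      obtain ⟨ℬ', hsub, hdec''⟩ := ih U (insert v W) (by
          have : (U \ insert v W).ncard < (U \ W).ncard := by
            refine Set.ncard_lt_ncard ⟨?_, fun h => ?_⟩
            · exact Set.sdiff_subset_sdiff_right (Set.subset_insert _ _)
            · exact (h ⟨hvU, hvW⟩).2 (Set.mem_insert _ _)
          omega) (Set.insert_subset hvU hWU) hv _ _ hdec'
        ⟨_, Set.mem_insert _ _, subset_rfl⟩ (by
          rintro x ⟨hx, hx0 | hx0⟩
          · exact Or.inr (hUU₀ ⟨hx, hx0⟩)
          · exact hx0) (by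
          rintro x hx y (hy | hy) hxy
          · rcases hedge x hx y hy hxy with h | h
            exacts [Or.inl (Or.inr h), Or.inr (Or.inr h)]
          · exact Or.inr hy)
      refine ⟨ℬ', (Set.subset_insert _ _).trans hsub, ?_⟩
      convert hdec'' using 1
      rw [Set.union_assoc, Set.union_eq_right.2 (Set.insert_subset hvU hWU)]
    -- a maximum independent set of the boundary
    obtain ⟨I, hIW, hI, hIcard⟩ : ∃ I ⊆ W, G.IsIndepSet I ∧ I.ncard = 4 * c := by
      unfold AlphaLe at hv
      push Not at hv
      obtain ⟨J, hJ, hJind, hJcard⟩ := hv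
      have h1 : J \ {v} ⊆ W := by
        rintro x ⟨hx, hxv⟩
        exact (hJ hx).resolve_left hxv
      have h2 : G.IsIndepSet (J \ {v}) := hJind.mono Set.sdiff_subset
      have h3 := hW _ h1 h2
      have h4 := Set.ncard_le_ncard_sdiff_add_ncard J {v}
      rw [Set.ncard_singleton] at h4
      exact ⟨_, h1, h2, by omega⟩
    obtain ⟨X', hX', hbal'⟩ := hsep I
    obtain ⟨X, hXU, hX, hbal⟩ : ∃ X ⊆ U, AlphaLe G X c ∧
        ∀ C ⊆ U \ X, ConnSet G C → 2 * (I ∩ C).ncard ≤ I.ncard := by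
      refine ⟨X' ∩ U, Set.inter_subset_right, hX'.mono Set.inter_subset_left le_rfl, fun C hC => ?_⟩
      exact hbal' C fun x hx h => (hC hx).2 ⟨h, (hC hx).1⟩
    have hdec₁ := LeafDecomposition.leaf (W ∪ X) B hdec hB (by
        rintro x ⟨hx0, hx | hx⟩
        · exact hWB hx
        · exact hWB (hUU₀ ⟨hXU hx, hx0⟩)) (by
        rintro x hx y (hy | hy) hxy
        · exact Or.inr (hWU₀ hy)
        · rcases hedge y (hXU hy) x hx hxy.symm with h | h
          exacts [Or.inr (hWU₀ h), Or.inl (Or.inl h)])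
      ((hW.union hX).mono subset_rfl (by omega))
    -- the components of `U \ X` are added one after another
    suffices hcomp : ∀ k, ∀ S ⊆ U \ X, S.ncard ≤ k →
        (∀ x ∈ S, ∀ y ∈ U \ X, G.Adj x y → y ∈ S) → ∀ ℬ₁, insert (W ∪ X) ℬ ⊆ ℬ₁ →
        LeafDecomposition G (5 * c) (U₀ ∪ (U \ S)) ℬ₁ →
        ∃ ℬ', ℬ ⊆ ℬ' ∧ LeafDecomposition G (5 * c) (U₀ ∪ U) ℬ' by
      refine hcomp _ (U \ X) subset_rfl le_rfl (fun _ _ y hy _ => hy) _ subset_rfl ?_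
      convert hdec₁ using 1
      rw [Set.sdiff_sdiff_cancel_left hXU, ← Set.union_assoc, Set.union_eq_left.2 hWU₀]
    intro k
    induction k with
    | zero =>
      intro S _ hS _ ℬ₁ hℬ₁ hdec'
      have : S = ∅ := by
        rw [← Set.ncard_eq_zero]; omega
      subst this
      rw [Set.sdiff_empty] at hdec'
      exact ⟨ℬ₁, (Set.subset_insert _ _).trans hℬ₁, hdec'⟩
    | succ k ihk =>
      intro S hSU hS hScl ℬ₁ hℬ₁ hdec'
      rcases S.eq_empty_or_nonempty with rfl | ⟨s, hs⟩
      · rw [Set.sdiff_empty] at hdec'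
        exact ⟨ℬ₁, (Set.subset_insert _ _).trans hℬ₁, hdec'⟩
      obtain ⟨C, hsC, hCS, hC, hCcl⟩ := (connSet_singleton G s).exists_component
        (Set.singleton_subset_iff.2 hs)
      have hCU : C ⊆ U \ X := hCS.trans hSU
      have hCcl' : ∀ x ∈ C, ∀ y ∈ U \ X, G.Adj x y → y ∈ C :=
        fun x hx y hy hxy => hCcl x hx y (hScl x (hCS hx) y hy hxy) hxy
      have hIC := hbal C hCU hC
      have hIX := hX (I ∩ X) Set.inter_subset_right (hI.mono Set.inter_subset_left)
      -- Of the `4 * c` elements of `I`, at most `2 * c` lie in `C` by balance and at most `c` in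
      -- `X` by independence, so at least `c` lie elsewhere.
      have hIrest : c ≤ (I \ (C ∪ X)).ncard := by
        have h1 := Set.ncard_inter_add_ncard_sdiff_eq_ncard I (C ∪ X)
        have h2 := Set.ncard_union_le (I ∩ C) (I ∩ X)
        rw [← Set.inter_union_distrib_left] at h2
        omega
      have hα : AlphaLe G (W ∩ C ∪ X) (4 * c) := by
        -- An independent `J ⊆ W ∩ C` stays independent after adding the part of `I` beyond `C ∪ X`,
        -- so $|J|+c\le 4c$. This leaves room `c` for `X` in the new boundary.
        have h1 : AlphaLe G (W ∩ C) (3 * c) := by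
          intro J hJ hJind
          have hdisj : Disjoint J (I \ (C ∪ X)) :=
            Set.disjoint_left.2 fun x hx hx' => hx'.2 (Or.inl (hJ hx).2)
          have hno : ∀ x ∈ J, ∀ y ∈ I \ (C ∪ X), ¬ G.Adj x y := fun x hx y hy hxy =>
            hy.2 (Or.inl (hCcl' x (hJ hx).2 y
              ⟨hWU (hIW hy.1), fun h => hy.2 (Or.inr h)⟩ hxy))
          have h2 := hW (J ∪ I \ (C ∪ X))
            (Set.union_subset (fun x hx => (hJ hx).1) (fun x hx => hIW hx.1)) (by
              rintro x (hx | hx) y (hy | hy) hne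
              · exact hJind hx hy hne
              · exact hno x hx y hy
              · exact fun h => hno y hy x hx h.symm
              · exact hI hx.1 hy.1 hne)
          rw [Set.ncard_union_eq hdisj] at h2
          omega
        exact (h1.union hX).mono subset_rfl (by omega)
      obtain ⟨ℬ₂, hℬ₂, hdec₂⟩ := ih (C ∪ X) (W ∩ C ∪ X) (by
          have h1 : (C ∪ X).ncard < U.ncard := by
            refine Set.ncard_lt_ncard ⟨Set.union_subset (fun x hx => (hCU hx).1) hXU, fun h => ?_⟩
            have : I \ (C ∪ X) = ∅ := by
              rw [Set.sdiff_eq_empty]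
              exact (hIW.trans hWU).trans h
            rw [this, Set.ncard_empty] at hIrest
            omega
          have h2 : ((C ∪ X) \ (W ∩ C ∪ X)).ncard ≤ (U \ W).ncard := by
            refine Set.ncard_le_ncard ?_
            rintro x ⟨hx | hx, hx'⟩
            · exact ⟨(hCU hx).1, fun h => hx' (Or.inl ⟨h, hx⟩)⟩
            · exact absurd (Or.inr hx) hx'
          omega) (Set.union_subset_union_left _ Set.inter_subset_right) hα _ _ hdec'
        ⟨W ∪ X, hℬ₁ (Set.mem_insert _ _), Set.union_subset_union_left _ Set.inter_subset_left⟩ (by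
          rintro x ⟨hx | hx, hx0 | hx0⟩
          · exact Or.inl ⟨hUU₀ ⟨(hCU hx).1, hx0⟩, hx⟩
          · exact absurd (hCS hx) hx0.2
          · exact Or.inr hx
          · exact Or.inr hx) (by
          rintro x (hx | hx) y hy hxy
          · have key : y ∈ U → x ∈ W ∩ C ∪ X ∨ y ∈ W ∩ C ∪ X := by
              intro hyU
              by_cases hyX : y ∈ X
              · exact Or.inr (Or.inr hyX)
              · have hyC := hCcl' x hx y ⟨hyU, hyX⟩ hxy
                rcases hy with hy | hy
                · exact Or.inr (Or.inl ⟨hUU₀ ⟨hyU, hy⟩, hyC⟩)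
                · exact absurd (hCS hyC) hy.2
            rcases hy with hy' | hy'
            · rcases hedge x (hCU hx).1 y hy' hxy with h | h
              · exact Or.inl (Or.inl ⟨h, hx⟩)
              · exact key (hWU h)
            · exact key hy'.1
          · exact Or.inl (Or.inr hx))
      refine ihk (S \ C) (Set.sdiff_subset.trans hSU) ?_ ?_ ℬ₂ (hℬ₁.trans hℬ₂) ?_
      · have : (S \ C).ncard < S.ncard := by
          refine Set.ncard_lt_ncard ⟨Set.sdiff_subset, fun h => ?_⟩
          exact (h hs).2 (hsC rfl)
        omega
      · intro x hx y hy hxy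
        exact ⟨hScl x hx.1 y hy hxy, fun h => hx.2 (hCcl' y h x (hSU hx.1) hxy.symm)⟩
      · convert hdec₂ using 1
        ext x
        simp only [Set.mem_union, Set.mem_sdiff]
        have := @hCU x
        have := @hXU x
        have := @hSU x
        simp only [Set.mem_sdiff] at *
        tauto

/-- Balanced separators of bounded independence number give a tree decomposition into bags of
bounded independence number. -/
theorem exists_treeDecomposition_of_separators [Finite V] {c : ℕ} (hc : 0 < c)
    (hsep : ∀ I : Set V, ∃ X : Set V, AlphaLe G X c ∧
      ∀ C, (∀ x ∈ C, x ∉ X) → ConnSet G C → 2 * (I ∩ C).ncard ≤ I.ncard) :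
    ∃ D : TreeDecomposition G, ∀ t, AlphaLe G (D.bag t) (5 * c) := by
  have h0 : ∀ m, AlphaLe G ∅ m := fun m I hI _ => by simp [Set.subset_empty_iff.1 hI]
  obtain ⟨ℬ, -, hdec⟩ := LeafDecomposition.extend hc hsep _ Set.univ ∅ le_rfl (Set.empty_subset _)
    (h0 _) ∅ {∅} (LeafDecomposition.single ∅ (h0 _)) ⟨∅, rfl, subset_rfl⟩ (by simp) (by simp)
  rw [Set.empty_union] at hdec
  obtain ⟨N, hN, T, bag, hT, -, hα, hU, hE, hconn⟩ := hdec.exists_tree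
  exact ⟨⟨N, hN, T, hT, bag, fun v => (hU v).1 trivial,
    fun x y hxy => hE x trivial y trivial hxy,
    fun v => ⟨(hconn v).connected_induce ((hU v).1 trivial), hT.isAcyclic.induce _⟩⟩, hα⟩

end Decompositions

/-! ### Destroying all copies by a packing argument; the explicit bound -/

section Packing

variable {V : Type u} {G : SimpleGraph V}

lemma IsFreeOf.mono {V' : Type v} {W : Type w} {G' : SimpleGraph V'} {H : SimpleGraph W}
    (h : IsFreeOf G H) (hG' : G' ⊴ G) : IsFreeOf G' H :=
  fun hH => h (hH.trans hG')

lemma IsFreeOf.of_indContained {V' : Type v} {W : Type w} {H' : SimpleGraph V'} {H : SimpleGraph W}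
    (h : IsFreeOf G H') (hH : H' ⊴ H) : IsFreeOf G H :=
  fun hG => h (hH.trans hG)

lemma induce_indContained (S : Set V) : G.induce S ⊴ G :=
  ⟨SimpleGraph.Embedding.induce S⟩

lemma induce_indContained_induce {S T : Set V} (h : S ⊆ T) : G.induce S ⊴ G.induce T :=
  ⟨⟨⟨fun x => ⟨x, h x.2⟩, fun _ _ e => Subtype.ext (Subtype.mk.inj e)⟩, Iff.rfl⟩⟩

lemma disjointCopies_succ_indContained {j : ℕ} {W : Type w} {H : SimpleGraph W}
    (φ : disjointCopies j H ↪g G) (ψ : H ↪g G)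
    (h : ∀ x w, ψ w ≠ φ x ∧ ¬ G.Adj (ψ w) (φ x)) : disjointCopies (j + 1) H ⊴ G := by
  refine ⟨⟨⟨fun x => if hx : (x.1 : ℕ) < j then φ (⟨x.1, hx⟩, x.2) else ψ x.2, ?_⟩, ?_⟩⟩
  · rintro ⟨i, x⟩ ⟨i', y⟩ e
    dsimp only at e
    split_ifs at e with h1 h2 h2
    · have := φ.injective e
      simp only [Prod.mk.injEq, Fin.ext_iff] at this ⊢
      exact this
    · exact absurd e.symm (h _ _).1
    · exact absurd e (h _ _).1
    · have := ψ.injective e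
      simp only [Prod.mk.injEq, Fin.ext_iff]
      exact ⟨by omega, this⟩
  · rintro ⟨i, x⟩ ⟨i', y⟩
    change G.Adj (if hx : (i : ℕ) < j then φ (⟨i, hx⟩, x) else ψ x)
      (if hx : (i' : ℕ) < j then φ (⟨i', hx⟩, y) else ψ y) ↔ _
    split_ifs with h1 h2 h2
    · rw [φ.map_adj_iff]
      simp only [disjointCopies, Fin.ext_iff]
    · refine iff_of_false (fun e => (h _ _).2 e.symm) ?_
      rintro ⟨rfl, -⟩
      exact h2 h1
    · refine iff_of_false (h _ _).2 ?_
      rintro ⟨rfl, -⟩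
      exact h1 h2
    · rw [ψ.map_adj_iff]
      have : i = i' := Fin.ext (by omega)
      simp [disjointCopies, this]

/-- Deleting the closed neighbourhood of a maximal family of anticomplete copies of `H`
destroys all copies of `H`. -/
lemma exists_closedNbhd_hitting [Finite V] {d k : ℕ} (hd : 0 < d) (hK : IsFreeOf G (starGraphK d))
    {W : Type w} [Finite W] {H : SimpleGraph W} (hG : IsFreeOf G (disjointCopies k H)) :
    ∃ Z : Set V, AlphaLe G Z (d * ((k - 1) * Nat.card W)) ∧ IsFreeOf (G.induce Zᶜ) H := by
  classical
  -- For the least `i` such that $iH$ is not contained, a copy of $(i-1)H$ exists and cannot be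
  -- extended, and $i-1\le k-1$.
  have hex : ∃ i, ¬ disjointCopies i H ⊴ G := ⟨k, hG⟩
  have hspec := Nat.find_spec hex
  have hle := Nat.find_min' hex hG
  have hmin : ∀ i < Nat.find hex, disjointCopies i H ⊴ G :=
    fun i hi => not_not.1 (Nat.find_min hex hi)
  rcases hn : Nat.find hex with _ | j
  · rw [hn] at hspec
    exact absurd (SimpleGraph.IsIndContained.of_isEmpty) hspec
  rw [hn] at hspec hle
  obtain ⟨φ⟩ := hmin j (by omega)
  refine ⟨closedNbhd G (Set.range φ), (alphaLe_closedNbhd hd hK _).mono subset_rfl ?_, ?_⟩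
  · refine Nat.mul_le_mul_left _ ?_
    rw [← Nat.card_coe_set_eq, Nat.card_range_of_injective φ.injective, Nat.card_prod,
      Nat.card_eq_fintype_card, Fintype.card_fin]
    exact Nat.mul_le_mul_right _ (by omega)
  · rintro ⟨ψ⟩
    refine hspec (disjointCopies_succ_indContained φ
      ((SimpleGraph.Embedding.induce _).comp ψ) fun x w => ?_)
    have := (ψ w).2
    exact ⟨fun e => this (Or.inl ⟨x, e.symm⟩), fun e => this (Or.inr ⟨_, ⟨x, rfl⟩, e.symm⟩)⟩

/-- Adding a set `Z` to every bag of a tree decomposition of `G - Z`. -/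
lemma exists_treeDecomposition_of_induce_compl [Finite V] {Z : Set V} {m z : ℕ}
    (D : TreeDecomposition (G.induce Zᶜ)) (hD : ∀ t, AlphaLe (G.induce Zᶜ) (D.bag t) m)
    (hZ : AlphaLe G Z z) : ∃ D' : TreeDecomposition G, ∀ t, AlphaLe G (D'.bag t) (m + z) := by
  have hmem : ∀ (v : V) (hv : v ∉ Z) (t : D.Node),
      v ∈ Subtype.val '' D.bag t ∪ Z ↔ (⟨v, hv⟩ : ↥(Zᶜ)) ∈ D.bag t := by
    intro v hv t
    constructor
    · rintro (⟨x, hx, rfl⟩ | h)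
      exacts [hx, absurd h hv]
    · exact fun h => Or.inl ⟨_, h, rfl⟩
  have hne : Nonempty D.Node := D.isTree.connected.nonempty
  refine ⟨⟨D.Node, D.finite_node, D.tree, D.isTree, fun t => Subtype.val '' D.bag t ∪ Z,
    ?_, ?_, ?_⟩, ?_⟩
  · intro v
    by_cases hv : v ∈ Z
    · exact ⟨hne.some, Or.inr hv⟩
    · obtain ⟨t, ht⟩ := D.exists_mem_bag ⟨v, hv⟩
      exact ⟨t, (hmem v hv t).2 ht⟩
  · intro x y hxy
    by_cases hx : x ∈ Z <;> by_cases hy : y ∈ Z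
    · exact ⟨hne.some, Or.inr hx, Or.inr hy⟩
    · obtain ⟨t, ht⟩ := D.exists_mem_bag ⟨y, hy⟩
      exact ⟨t, Or.inr hx, (hmem y hy t).2 ht⟩
    · obtain ⟨t, ht⟩ := D.exists_mem_bag ⟨x, hx⟩
      exact ⟨t, (hmem x hx t).2 ht, Or.inr hy⟩
    · obtain ⟨t, htx, hty⟩ := D.exists_edge_bag ⟨x, hx⟩ ⟨y, hy⟩ hxy
      exact ⟨t, (hmem x hx t).2 htx, (hmem y hy t).2 hty⟩
  · intro v
    by_cases hv : v ∈ Z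
    · have : {t | v ∈ Subtype.val '' D.bag t ∪ Z} = Set.univ :=
        Set.eq_univ_of_forall fun t => Or.inr hv
      rw [this]
      exact ⟨(connSet_univ D.isTree.connected.preconnected).connected_induce Set.univ_nonempty,
        D.isTree.isAcyclic.induce _⟩
    · have : {t | v ∈ Subtype.val '' D.bag t ∪ Z} = {t | (⟨v, hv⟩ : ↥(Zᶜ)) ∈ D.bag t} :=
        Set.ext fun t => hmem v hv t
      rw [this]
      exact D.subtree _
  · intro t
    refine AlphaLe.union (fun I hI hind => ?_) hZ
    have hI' : I = Subtype.val '' (Subtype.val ⁻¹' I : Set ↥(Zᶜ)) := by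
      rw [Subtype.image_preimage_coe, Set.inter_eq_right.2]
      intro x hx
      obtain ⟨y, -, rfl⟩ := hI hx
      exact y.2
    rw [hI', Set.ncard_image_of_injective _ Subtype.val_injective]
    refine hD t _ (fun x hx => ?_) (fun x hx y hy hxy h => ?_)
    · obtain ⟨y, hy, e⟩ := hI hx
      rwa [← Subtype.ext e]
    · exact hind hx hy (fun e => hxy (Subtype.ext e)) h

lemma treeIndepNum_le [Finite V] {m : ℕ} (D : TreeDecomposition G)
    (hD : ∀ t, AlphaLe G (D.bag t) m) : treeIndepNum G ≤ m := by
  have hne : Nonempty D.Node := D.isTree.connected.nonempty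
  have hle : treeIndepNum G ≤ D.indepNum := Nat.sInf_le ⟨D, rfl⟩
  refine hle.trans (ciSup_le fun t => ?_)
  obtain ⟨s, hs⟩ := (G.induce (D.bag t)).exists_isNIndepSet_indepNum
  rw [← hs.card_eq, ← Set.ncard_coe_finset, ← Set.ncard_image_of_injective _ Subtype.val_injective]
  refine hD t _ ?_ ?_
  · rintro _ ⟨x, -, rfl⟩
    exact x.2
  · rintro _ ⟨x, hx, rfl⟩ _ ⟨y, hy, rfl⟩ hne h
    exact hs.isIndepSet hx hy (fun e => hne (congrArg _ e)) h

lemma card_lineSubdividedClaw (p : ℕ) : Nat.card (subdividedClaw p).edgeSet = 3 * p := by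
  rw [← Nat.card_congr (Equiv.ofBijective _ (clawEdge_bijective p)), Nat.card_prod]
  simp

lemma card_subdividedClaw (p : ℕ) : Nat.card (Option (Fin 3 × Fin p)) = 3 * p + 1 := by
  rw [Finite.card_option, Nat.card_prod]
  simp

/-- With $c=3d^2(p+1)$ the decomposition costs $5c=15d^2(p+1)$, and the two deleted sets cost
$d(k-1)(3p+1)$ and $d(k-1)3p$. The stated bound exceeds the sum. -/
theorem treeIndepNum_lt [Finite V] {d k p : ℕ} (hd : 0 < d) (hk : 0 < k)
    (hK : IsFreeOf G (starGraphK d))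
    (hS : IsFreeOf G (disjointCopies k (subdividedClaw p)))
    (hT : IsFreeOf G (disjointCopies k (lineSubdividedClaw p))) :
    treeIndepNum G < 6 * d * k * (p + 1) + 20 * d ^ 4 * (p + 1) := by
  obtain ⟨Z₁, hZ₁, hS'⟩ := exists_closedNbhd_hitting hd hK hS
  obtain ⟨Z₂, hZ₂, hT'⟩ := exists_closedNbhd_hitting hd hK hT
  rw [card_subdividedClaw] at hZ₁
  rw [card_lineSubdividedClaw] at hZ₂
  have h1 : IsFreeOf (G.induce (Z₁ ∪ Z₂)ᶜ) (subdividedClaw p) :=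
    hS'.mono (induce_indContained_induce (Set.compl_subset_compl.2 Set.subset_union_left))
  have h2 : IsFreeOf (G.induce (Z₁ ∪ Z₂)ᶜ) (lineSubdividedClaw p) :=
    hT'.mono (induce_indContained_induce (Set.compl_subset_compl.2 Set.subset_union_right))
  have h3 : IsFreeOf (G.induce (Z₁ ∪ Z₂)ᶜ) (starGraphK d) := hK.mono (induce_indContained _)
  obtain ⟨D, hD⟩ := exists_treeDecomposition_of_separators (by positivity)
    (exists_balanced_separator hd h3 h1 h2)
  obtain ⟨D', hD'⟩ := exists_treeDecomposition_of_induce_compl D hD (hZ₁.union hZ₂)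
  refine (treeIndepNum_le D' hD').trans_lt ?_
  obtain ⟨k, rfl⟩ : ∃ l, k = l + 1 := ⟨k - 1, by omega⟩
  rw [Nat.add_sub_cancel]
  have hd2 : d ^ 2 ≤ d ^ 4 := Nat.pow_le_pow_right hd (by omega)
  have h4 : 15 * d ^ 2 * (p + 1) ≤ 20 * d ^ 4 * (p + 1) :=
    Nat.mul_le_mul_right _ (Nat.mul_le_mul (by omega) hd2)
  have h5 : d * (k * (3 * p + 1)) + d * (k * (3 * p)) < 6 * d * (k + 1) * (p + 1) := by
    have : 0 < d * (k * 5 + 6 * p + 6) := by positivity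
    calc _ < d * (k * (3 * p + 1)) + d * (k * (3 * p)) + d * (k * 5 + 6 * p + 6) := by omega
      _ = _ := by ring
  have h6 : 5 * (d * (3 * (d * (p + 1)))) = 15 * d ^ 2 * (p + 1) := by ring
  omega

end Packing

/-! ### Trees with at most three leaves embed in a subdivided claw -/

section FewLeaves

variable {A : Type u} {T : SimpleGraph A}

/-- Extending geodesics from `c` to `u` and to `u'` by `v` gives two paths from `c` to `v`; in a
tree they coincide, hence so do their penultimate vertices. -/
lemma SimpleGraph.IsTree.parent_unique (hT : T.IsTree) {c u u' v : A} (h : T.Adj u v)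
    (h' : T.Adj u' v) (hd : T.dist c v = T.dist c u + 1) (hd' : T.dist c v = T.dist c u' + 1) :
    u = u' := by
  obtain ⟨p, hp⟩ := hT.connected.exists_walk_length_eq_dist c u
  obtain ⟨q, hq⟩ := hT.connected.exists_walk_length_eq_dist c u'
  have hp' : (p.concat h).IsPath :=
    SimpleGraph.Walk.isPath_of_length_eq_dist _ (by rw [SimpleGraph.Walk.length_concat, hp, hd])
  have hq' : (q.concat h').IsPath :=
    SimpleGraph.Walk.isPath_of_length_eq_dist _ (by rw [SimpleGraph.Walk.length_concat, hq, hd'])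
  have := (hT.isAcyclic.subsingleton_path c v).elim ⟨_, hp'⟩ ⟨_, hq'⟩
  have h2 := congrArg SimpleGraph.Walk.penultimate (congrArg Subtype.val this)
  simpa using h2

lemma SimpleGraph.Connected.exists_parent (hT : T.Connected) {c v : A} (hv : v ≠ c) :
    ∃ u, T.Adj u v ∧ T.dist c v = T.dist c u + 1 := by
  obtain ⟨p, hp⟩ := hT.exists_walk_length_eq_dist v c
  cases p with
  | nil => exact absurd rfl hv
  | @cons _ u _ h q =>
    refine ⟨u, h.symm, le_antisymm ?_ ?_⟩
    · have h1 := hT.dist_triangle (u := c) (v := u) (w := v)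
      rwa [SimpleGraph.dist_eq_one_iff_adj.2 h.symm] at h1
    · have h1 := SimpleGraph.dist_le q
      rw [SimpleGraph.Walk.length_cons] at hp
      rw [SimpleGraph.dist_comm (u := c), SimpleGraph.dist_comm (u := c)]
      omega

/-- A tree with at most three leaves has a vertex of degree at most three such that all other
vertices have degree at most two. -/
lemma exists_center_of_few_leaves [Finite A] (hT : T.IsTree) (hleaf : (leafSet T).ncard ≤ 3) :
    ∃ c, (T.neighborSet c).ncard ≤ 3 ∧ ∀ v, v ≠ c → (T.neighborSet v).ncard ≤ 2 := by
  classical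
  have := Fintype.ofFinite A
  have hne : Nonempty A := hT.connected.nonempty
  have hdeg : ∀ v, (T.neighborSet v).ncard = T.degree v := fun v => by
    rw [Set.ncard_eq_toFinset_card', ← SimpleGraph.neighborFinset_def,
      SimpleGraph.card_neighborFinset_eq_degree]
  simp only [hdeg]
  obtain ⟨c, -, hc⟩ := Finset.exists_max_image Finset.univ (fun v => T.degree v)
    Finset.univ_nonempty
  refine ⟨c, ?_⟩
  rcases Nat.lt_or_ge 1 (Fintype.card A) with hcard | hcard
  · have hnt : Nontrivial A := Fintype.one_lt_card_iff_nontrivial.1 hcard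
    have hpos : ∀ v, 0 < T.degree v := fun v =>
      hT.connected.preconnected.degree_pos_of_nontrivial v
    have hsum : ∑ v, T.degree v + 2 = 2 * Fintype.card A := by
      rw [T.sum_degrees_eq_twice_card_edges, ← hT.card_edgeFinset]
      ring
    have hleaves : ∑ v, (if T.degree v = 1 then 1 else 0) ≤ 3 := by
      rw [← Finset.card_filter]
      refine le_trans (le_of_eq ?_) hleaf
      rw [← Set.ncard_coe_finset]
      congr 1
      ext v
      simp [leafSet, hdeg]
    -- Truncated subtraction is intended: for degrees at least 1, $\deg+[\deg=1]=2+(\deg-2)$. Summed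
    -- against $\sum\deg=2|A|-2$, this makes the total excess over 2 equal to the number of leaves
    -- minus 2.
    have hexcess : ∑ v, (T.degree v - 2) ≤ 1 := by
      have h1 : ∑ v, (T.degree v + if T.degree v = 1 then 1 else 0) =
          ∑ v : A, (2 + (T.degree v - 2)) := by
        refine Finset.sum_congr rfl fun v _ => ?_
        have := hpos v
        split_ifs <;> omega
      rw [Finset.sum_add_distrib, Finset.sum_add_distrib, Finset.sum_const, Finset.card_univ,
        smul_eq_mul] at h1
      omega
    constructor
    · have := Finset.single_le_sum (f := fun v => T.degree v - 2) (fun _ _ => Nat.zero_le _)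
        (Finset.mem_univ c)
      omega
    · intro v hv
      have h1 := Finset.sum_le_sum_of_subset (f := fun v => T.degree v - 2)
        (Finset.subset_univ {v, c})
      rw [Finset.sum_pair hv] at h1
      have h2 := hc v (Finset.mem_univ v)
      omega
  · have hlt : ∀ v, T.degree v < Fintype.card A := fun v => T.degree_lt_card_verts v
    refine ⟨?_, fun v _ => ?_⟩
    · have := hlt c; omega
    · have := hlt v; omega

/-- Root the tree at the vertex `c` of `exists_center_of_few_leaves`. Every other vertex has at most
one child, so it is determined by its distance from `c` and the neighbour of `c` below which it
hangs. These are its position and its leg in the claw. -/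
lemma subdividedClaw_contains_tree [Finite A] (hT : T.IsTree) (hleaf : (leafSet T).ncard ≤ 3)
    {p : ℕ} (hp : Nat.card A ≤ p) : T ⊴ subdividedClaw p := by
  classical
  obtain ⟨c, hc3, h2⟩ := exists_center_of_few_leaves hT hleaf
  set δ : A → ℕ := fun v => T.dist c v with hδ
  have hδ0 : ∀ v, δ v = 0 ↔ v = c := fun v => by
    rw [hδ]; simp only
    rw [hT.connected.dist_eq_zero_iff, eq_comm]
  have hδc : δ c = 0 := (hδ0 c).2 rfl
  have hδadj : ∀ v w, T.Adj v w → δ v = δ w + 1 ∨ δ w = δ v + 1 :=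
    fun v w h => hT.dist_eq_dist_add_one_of_adj c h
  have hδ1 : ∀ v, δ v = 1 ↔ T.Adj c v := fun v => SimpleGraph.dist_eq_one_iff_adj
  have hδp : ∀ v, δ v < p := by
    intro v
    have := Fintype.ofFinite A
    obtain ⟨q, hq, hq'⟩ := hT.connected.exists_path_of_dist c v
    have h := hq.length_lt
    rw [hq', ← Nat.card_eq_fintype_card] at h
    exact h.trans_le hp
  have hpar : ∀ v, ∃ u, v ≠ c → T.Adj u v ∧ δ v = δ u + 1 := by
    intro v
    by_cases hv : v = c
    · exact ⟨v, fun h => absurd hv h⟩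
    · obtain ⟨u, hu⟩ := hT.connected.exists_parent hv
      exact ⟨u, fun _ => hu⟩
  choose par hpar using hpar
  have hparu : ∀ v w, T.Adj v w → δ w = δ v + 1 → par w = v := by
    intro v w h hd
    have hw : w ≠ c := fun e => by rw [e, hδc] at hd; omega
    exact hT.parent_unique (hpar w hw).1 h (hpar w hw).2 hd
  -- Climbing `δ v - 1` times from `v ≠ c` stops at the neighbour of `c` on its branch; the value at
  -- `c` is irrelevant.
  let br : A → A := fun v => par^[δ v - 1] v
  have hbr1 : ∀ v, δ v = 1 → br v = v := fun v h => by simp [br, h]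
  have hbrpar : ∀ w, 2 ≤ δ w → br (par w) = br w := by
    intro w hw
    have hwc : w ≠ c := fun e => by rw [e, hδc] at hw; omega
    have h1 := (hpar w hwc).2
    have h3 : δ w - 1 = (δ (par w) - 1) + 1 := by omega
    simp only [br]
    rw [h3, Function.iterate_succ_apply]
  have hbrN : ∀ n v, δ v = n + 1 → T.Adj c (br v) := by
    intro n
    induction n with
    | zero => intro v hv; rw [hbr1 v hv]; exact (hδ1 v).1 hv
    | succ n ih =>
      intro v hv
      have hvc : v ≠ c := fun e => by rw [e, hδc] at hv; omega
      rw [← hbrpar v (by omega)]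
      have := (hpar v hvc).2
      exact ih _ (by omega)
  have hbrinj : ∀ n v w, δ v = n + 1 → δ w = n + 1 → br v = br w → v = w := by
    intro n
    induction n with
    | zero => intro v w hv hw h; rwa [hbr1 v hv, hbr1 w hw] at h
    | succ n ih =>
      intro v w hv hw h
      have hvc : v ≠ c := fun e => by rw [e, hδc] at hv; omega
      have hwc : w ≠ c := fun e => by rw [e, hδc] at hw; omega
      obtain ⟨hv1, hv2⟩ := hpar v hvc
      obtain ⟨hw1, hw2⟩ := hpar w hwc
      have he : par v = par w := by
        refine ih _ _ (by omega) (by omega) ?_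
        rw [hbrpar v (by omega), hbrpar w (by omega), h]
      by_contra hne
      have huc : par v ≠ c := fun e => by rw [e, hδc] at hv2; omega
      obtain ⟨hu1, hu2⟩ := hpar _ huc
      -- Two distinct children together with its own parent would give `par v` degree three,
      -- although it is not the centre.
      have hsub : ({v, w, par (par v)} : Set A) ⊆ T.neighborSet (par v) := by
        rintro x (rfl | rfl | rfl)
        exacts [hv1, he ▸ hw1, hu1.symm]
      have h3 := (Set.ncard_le_ncard hsub).trans (h2 _ huc)
      have h4 : v ≠ par (par v) := fun e => by rw [← e] at hu2; omega
      have h5 : w ≠ par (par v) := fun e => by rw [← e] at hu2; omega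
      rw [Set.ncard_insert_of_notMem (by simp [hne, h4]), Set.ncard_pair h5] at h3
      omega
  obtain ⟨ι, hι⟩ : ∃ ι : A → Fin 3, Set.InjOn ι (T.neighborSet c) := by
    let e : T.neighborSet c ↪ Fin 3 := (Finite.equivFin _).toEmbedding.trans (Fin.castLEEmb hc3)
    refine ⟨fun a => if h : a ∈ T.neighborSet c then e ⟨a, h⟩ else 0, fun a ha b hb hab => ?_⟩
    simp only [dif_pos ha, dif_pos hb] at hab
    exact congrArg Subtype.val (e.injective hab)
  have hbrmem : ∀ v, v ≠ c → br v ∈ T.neighborSet c := by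
    intro v hv
    have : δ v ≠ 0 := fun h => hv ((hδ0 v).1 h)
    exact hbrN (δ v - 1) v (by omega)
  have hkey : ∀ v w, v ≠ c → w ≠ c → ι (br v) = ι (br w) → δ v = δ w → v = w := by
    intro v w hv hw h hd
    have : δ v ≠ 0 := fun h => hv ((hδ0 v).1 h)
    exact hbrinj (δ v - 1) v w (by omega) (by omega) (hι (hbrmem v hv) (hbrmem w hw) h)
  have hsucc : ∀ v w, v ≠ c → w ≠ c →
      (T.Adj v w ∧ δ w = δ v + 1 ↔ ι (br v) = ι (br w) ∧ δ w = δ v + 1) := by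
    intro v w hv hw
    have hv0 : δ v ≠ 0 := fun h => hv ((hδ0 v).1 h)
    constructor
    · rintro ⟨h, hd⟩
      refine ⟨?_, hd⟩
      rw [← hbrpar w (by omega), hparu v w h hd]
    · rintro ⟨h, hd⟩
      obtain ⟨h1, h3⟩ := hpar w hw
      refine ⟨?_, hd⟩
      have hpc : par w ≠ c := fun e => by rw [e, hδc] at h3; omega
      have : v = par w := by
        refine hkey v (par w) hv hpc ?_ (by omega)
        rw [hbrpar w (by omega), h]
      rw [this]; exact h1
  refine ⟨⟨⟨fun v => if v = c then none else
    some (ι (br v), ⟨δ v - 1, (Nat.sub_le _ _).trans_lt (hδp v)⟩), ?_⟩, ?_⟩⟩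
  · intro v w h
    by_cases hv : v = c <;> by_cases hw : w = c
    · rw [hv, hw]
    · simp [hv, hw] at h
    · simp [hv, hw] at h
    · simp only [hv, hw, if_false, Option.some.injEq, Prod.mk.injEq, Fin.mk.injEq] at h
      have hv0 : δ v ≠ 0 := fun h => hv ((hδ0 v).1 h)
      have hw0 : δ w ≠ 0 := fun h => hw ((hδ0 w).1 h)
      exact hkey v w hv hw h.1 (by omega)
  · intro v w
    change (subdividedClaw p).Adj
      (if v = c then none else some (ι (br v), ⟨δ v - 1, (Nat.sub_le _ _).trans_lt (hδp v)⟩))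
      (if w = c then none else some (ι (br w), ⟨δ w - 1, (Nat.sub_le _ _).trans_lt (hδp w)⟩)) ↔ _
    have hcase : ∀ w, w ≠ c → (δ w - 1 = 0 ↔ T.Adj c w) := by
      intro w hw
      have hw0 : δ w ≠ 0 := fun h => hw ((hδ0 w).1 h)
      rw [← hδ1]; omega
    by_cases hv : v = c <;> by_cases hw : w = c
    · rw [if_pos hv, if_pos hw, hv, hw]
      exact iff_of_false (fun h => h) T.irrefl
    · rw [if_pos hv, if_neg hw, hv]
      exact hcase w hw
    · rw [if_neg hv, if_pos hw, hw, T.adj_comm]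
      exact hcase v hv
    · rw [if_neg hv, if_neg hw]
      have hv0 : δ v ≠ 0 := fun h => hv ((hδ0 v).1 h)
      have hw0 : δ w ≠ 0 := fun h => hw ((hδ0 w).1 h)
      have h1 := hsucc v w hv hw
      have h3 := hsucc w v hw hv
      change (ι (br v) = ι (br w) ∧ (δ v - 1 + 1 = δ w - 1 ∨ δ w - 1 + 1 = δ v - 1)) ↔ T.Adj v w
      constructor
      · rintro ⟨h, hd | hd⟩
        · exact (h1.2 ⟨h, by omega⟩).1
        · exact (h3.2 ⟨h.symm, by omega⟩).1.symm
      · intro h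
        rcases hδadj v w h with hd | hd
        · exact ⟨(h3.1 ⟨h.symm, hd⟩).1.symm, Or.inr (by omega)⟩
        · exact ⟨(h1.1 ⟨h, hd⟩).1, Or.inl (by omega)⟩

end FewLeaves

/-! ### The families $\mathcal S$ and $L(\mathcal S)$ -/

section Families

/-- A graph whose components all embed in `H` embeds in sufficiently many copies of `H`. -/
lemma disjointCopies_contains_of_components {A : Type u} [Finite A] {S : SimpleGraph A} {W : Type w}
    {H : SimpleGraph W} (h : ∀ C : S.ConnectedComponent, C.toSimpleGraph ⊴ H) {k : ℕ}
    (hk : Nat.card A ≤ k) : S ⊴ disjointCopies k H := by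
  have φ := fun C => (h C).some
  have hcard : Nat.card S.ConnectedComponent ≤ k :=
    (Nat.card_le_card_of_surjective S.connectedComponentMk Quot.mk_surjective).trans hk
  let e : S.ConnectedComponent ↪ Fin k :=
    (Finite.equivFin _).toEmbedding.trans (Fin.castLEEmb hcard)
  have hmem : ∀ v, v ∈ (S.connectedComponentMk v).supp := fun v => rfl
  let ψ : A → W := fun v => φ (S.connectedComponentMk v) ⟨v, hmem v⟩
  -- Stating this for an arbitrary component containing `w` lets two vertices of one component be
  -- compared under the same embedding without transport.
  have hψ : ∀ (C) (w : A) (hw : w ∈ C.supp), ψ w = φ C ⟨w, hw⟩ := by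
    rintro C w rfl
    rfl
  refine ⟨⟨⟨fun v => (e (S.connectedComponentMk v), ψ v), ?_⟩, ?_⟩⟩
  · intro v w hvw
    simp only [Prod.mk.injEq] at hvw
    obtain ⟨h1, h2⟩ := hvw
    rw [hψ _ v (hmem v), hψ _ w (e.injective h1).symm] at h2
    exact congrArg Subtype.val ((φ _).injective h2)
  · intro v w
    change (e (S.connectedComponentMk v) = e (S.connectedComponentMk w) ∧ H.Adj (ψ v) (ψ w)) ↔
      S.Adj v w
    rw [e.injective.eq_iff]
    constructor
    · rintro ⟨h1, h2⟩
      rw [hψ _ v (hmem v), hψ _ w h1.symm, (φ _).map_adj_iff] at h2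
      exact h2
    · intro hvw
      have h1 : S.connectedComponentMk v = S.connectedComponentMk w :=
        SimpleGraph.ConnectedComponent.sound hvw.reachable
      refine ⟨h1, ?_⟩
      rw [hψ _ v (hmem v), hψ _ w h1.symm, (φ _).map_adj_iff]
      exact hvw

lemma InFamilyS.indContained {A : Type u} {S : SimpleGraph A} (hS : InFamilyS S) {k p : ℕ}
    (hk : Nat.card A ≤ k) (hp : Nat.card A ≤ p) : S ⊴ disjointCopies k (subdividedClaw p) := by
  obtain ⟨hfin, hcomp⟩ := hS
  refine disjointCopies_contains_of_components (fun C => ?_) hk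
  exact subdividedClaw_contains_tree (hcomp C).1 (hcomp C).2
    ((Nat.card_le_card_of_injective _ Subtype.val_injective).trans hp)

/-- Every edge of $kH$ lies in a single copy, and edges in different copies share no end, so the two
graphs are in fact isomorphic. -/
lemma lineGraph_disjointCopies_indContained (k : ℕ) {W : Type w} (H : SimpleGraph W) :
    (disjointCopies k H).lineGraph ⊴ disjointCopies k H.lineGraph := by
  let f : Fin k × H.edgeSet → (disjointCopies k H).edgeSet := fun x =>
    ⟨x.2.1.map (Prod.mk x.1), by
      obtain ⟨i, ⟨e, he⟩⟩ := x
      induction e with | _ a b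
      exact ⟨rfl, he⟩⟩
  have hmem : ∀ x v, v ∈ (f x : Sym2 (Fin k × W)) ↔ v.1 = x.1 ∧ v.2 ∈ (x.2 : Sym2 W) := by
    rintro ⟨i, e⟩ ⟨j, a⟩
    simp only [f, Sym2.mem_map, Prod.mk.injEq]
    constructor
    · rintro ⟨b, hb, rfl, rfl⟩
      exact ⟨rfl, hb⟩
    · rintro ⟨rfl, ha⟩
      exact ⟨a, ha, rfl, rfl⟩
  have hf : Function.Bijective f := by
    constructor
    · rintro ⟨i, e⟩ ⟨j, e'⟩ h
      have h' : ∀ v, v ∈ (f (i, e) : Sym2 (Fin k × W)) ↔ v ∈ (f (j, e') : Sym2 (Fin k × W)) :=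
        fun v => by rw [h]
      simp only [hmem] at h'
      have hij : i = j := by
        obtain ⟨e, he⟩ := e
        induction e with | _ a b
        exact ((h' (i, a)).1 ⟨rfl, Sym2.mem_mk_left a b⟩).1
      subst hij
      refine Prod.ext rfl (Subtype.ext (Sym2.ext fun a => ?_))
      simpa using h' (i, a)
    · rintro ⟨e, he⟩
      induction e with | _ x y
      obtain ⟨i, a⟩ := x
      obtain ⟨j, b⟩ := y
      obtain ⟨h, hab⟩ := he
      simp only at h
      subst h
      exact ⟨(i, ⟨s(a, b), hab⟩), rfl⟩
  have hadj : ∀ x y, (disjointCopies k H).lineGraph.Adj (f x) (f y) ↔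
      (disjointCopies k H.lineGraph).Adj x y := by
    intro x y
    rw [SimpleGraph.lineGraph_adj_iff_exists, hf.1.ne_iff]
    change _ ↔ x.1 = y.1 ∧ H.lineGraph.Adj x.2 y.2
    rw [SimpleGraph.lineGraph_adj_iff_exists]
    simp only [hmem]
    constructor
    · rintro ⟨hne, v, ⟨h1, h2⟩, h3, h4⟩
      have h5 : x.1 = y.1 := h1.symm.trans h3
      exact ⟨h5, fun h => hne (Prod.ext h5 h), v.2, h2, h4⟩
    · rintro ⟨h, hne, v, h1, h2⟩
      exact ⟨fun e => hne (congrArg Prod.snd e), (x.1, v), ⟨rfl, h1⟩, h, h2⟩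
  let iso : disjointCopies k H.lineGraph ≃g (disjointCopies k H).lineGraph :=
    ⟨Equiv.ofBijective f hf, hadj _ _⟩
  exact ⟨iso.symm.toEmbedding⟩

/-- Line graphs preserve induced containment, so this follows from the embedding of the root graph
in $kS_p$. A threshold instead of fixed parameters allows one choice of `k` and `p` to serve both
excluded graphs. -/
lemma InFamilyLS.indContained {B : Type u} {T : SimpleGraph B} (hT : InFamilyLS T) :
    ∃ n, ∀ k p, n ≤ k → n ≤ p → T ⊴ disjointCopies k (lineSubdividedClaw p) := by
  obtain ⟨n, H, hH, ⟨e⟩⟩ := hT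
  refine ⟨n, fun k p hk hp => ?_⟩
  have h := hH.indContained (k := k) (p := p) (by simpa using hk) (by simpa using hp)
  exact (SimpleGraph.IsIndContained.trans ⟨e.toEmbedding⟩ h.lineGraph).trans
    (lineGraph_disjointCopies_indContained k _)

end Families

theorem mainTheorem1 :
    (∀ d : ℕ, 0 < d →
      ∀ (A : Type v) (S : SimpleGraph A), InFamilyS S →
      ∀ (B : Type w) (T : SimpleGraph B), InFamilyLS T →
        ∃ c : ℕ, ∀ (V : Type u) [Finite V] (G : SimpleGraph V),
          IsFreeOf G (starGraphK d) → IsFreeOf G S → IsFreeOf G T →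
            treeIndepNum G ≤ c) ∧
    (∀ d k p : ℕ, 0 < d → 0 < k → 0 < p →
      ∀ (V : Type u) [Finite V] (G : SimpleGraph V),
        IsFreeOf G (starGraphK d) →
        IsFreeOf G (disjointCopies k (subdividedClaw p)) →
        IsFreeOf G (disjointCopies k (lineSubdividedClaw p)) →
          treeIndepNum G < 6 * d * k * (p + 1) + 20 * d ^ 4 * (p + 1)) := by
  refine ⟨fun d hd A S hS B T hT => ?_,
    fun d k p hd hk _ V _ G hK hS hT => treeIndepNum_lt hd hk hK hS hT⟩
  obtain ⟨n, hn⟩ := hT.indContained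
  refine ⟨_, fun V _ G hK hGS hGT => (treeIndepNum_lt (k := Nat.card A + n + 1)
    (p := Nat.card A + n + 1) hd (by omega) hK ?_ ?_).le⟩
  · exact hGS.of_indContained (hS.indContained (by omega) (by omega))
  · exact hGT.of_indContained (hn _ _ (by omega) (by omega))
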